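/- Let $T$ be the set of functions $f:\omega\to\omega$ with finite range. A condition $p$ consists of an unbounded sequence $g_p:\omega\to\omega$ and a number $\mathrm{stem}(p)$ such that $g_p$ is non-decreasing from $\mathrm{stem}(p)$ on and $g_p(i)\le g_p(\mathrm{stem}(p))$ for all $i<\mathrm{stem}(p)$. Give $T$ the topology generated by the sets $\{f\in T : f(n)=g_p(n)\text{ for } n<\mathrm{stem}(p),\ f(n)\le g_p(n)\text{ for } n\ge \mathrm{stem}(p)\}$, for all conditions $p$. Let $M$ be the full topological model over $T$. Its elements (names) are, inductively, the sets $\sigma=\{\langle\sigma_j,r_j\rangle : j\in J\}$ with $\sigma_j$ a name and $r_j$ an open subset of $T$. Truth values are open subsets of $T$: $[\![x\in y]\!]=\bigcup_{\langle z,r\rangle\in y} r\cap[\![x=z]\!]$; $[\![x=y]\!]$ is the truth value of "every element of $x$ is an element of $y$ and vice versa"; connectives and quantifiers over $M$ are interpreted in the complete Heyting algebra of open sets. $T\Vdash\varphi$ means $[\![\varphi]\!]=T$. Ground-model sets have the canonical names $\hat x=\{\langle\hat y,T\rangle : y\in x\}$, and the natural numbers of $M$ are $\hat\omega$. The generic term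 is $\mathcal G=\{\langle\hat r,r\rangle : r\subseteq T\text{ open}\}$. Let $G$ be the name $\{\langle \widehat{(n,x)},\{f\in T: f(n)=x\}\rangle : n,x\in\omega\}$ and $\mathrm{rng}(G)$ the name $\{\langle\hat x,\{f\in T: f(n)=x\}\rangle : n,x\in\omega\}$. In $M$, a set $A$ of natural numbers is *countable* if it is the range of a function with domain the natural numbers; it is *pseudo-bounded* if every sequence $(a_n)$ of members of $A$ satisfies $\lim_n a_n/n=0$, i.e. for every $k\in\mathbb N$ there is $N\in\mathbb N$ with $k\,a_n<n$ for all $n\ge N$; it is *bounded* if some $B\in\mathbb N$ satisfies $x\le B$ for all $x\in A$. BD-$\mathbb N$ is the statement that every countable pseudo-bounded set of natural numbers is bounded. **Theorem.** 1. $T\Vdash$ $G$ is the function determined by the generic term (that is, for all $z$: $z\in G$ if and only if there is $r\in\mathcal G$ with $z\in f$ for all $f\in r$), $G$ is a function from $\mathbb N$ to $\mathbb N$, and $\mathrm{rng}(G)$ is its range. 2. $T\Vdash$ $\mathrm{rng}(G)$ is a set of natural numbers which is countable and pseudo-bounded, and it is not bounded. 3. Consequently $T\Vdash\neg\,$BD-$\mathbb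 N$. 4. $T\Vdash$ Dependent Choice: for every formula $\varphi(x,y)$ of the language of set theory with parameters from $M$, $T$ forces both (a) if $\forall x\,\exists y\,\varphi(x,y)$, then for every $x_0$ there is a function $a$ on $\mathbb N$ with $a_0=x_0$ and $\varphi(a_n,a_{n+1})$ for all $n$; and (b) for every set $A$, if $\forall x\in A\,\exists y\in A\ \varphi(x,y)$, then for every $x_0\in A$ there is a function $a:\mathbb N\to A$ with $a_0=x_0$ and $\varphi(a_n,a_{n+1})$ for all $n$. -/

import Mathlib

universe u v

namespace TopModel

open TopologicalSpace

/-! ### Heyting-valued names over a complete Heyting algebra -/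

/-- A name (term): a family of pairs `⟨σ_j, r_j⟩` with `σ_j` a name and `r_j` a truth value,
indexed by a ground-model set `J`. For `H = Opens T` these are the elements of the full
topological model over `T`; the ground model `V` is the universe of sets coded in `Type u`. -/
inductive Name (H : Type v) : Type (max (u + 1) v)
  | mk (J : Type u) (elt : J → Name H) (val : J → H) : Name H

/-- The canonical name `x̂ = {⟨ŷ, ⊤⟩ | y ∈ x}` of a ground-model set `x`. -/
def check {H : Type v} [Order.Frame H] : PSet.{u} → Name.{u, v} H
  | PSet.mk J A => Name.mk J (fun j => check (A j)) (fun _ => ⊤)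

section Semantics

variable {H : Type v} [Order.Frame H]

/-- The truth value of `x = y`: every element of `x` is equal to some element of `y`,
and vice versa. -/
def eqV : Name.{u, v} H → Name.{u, v} H → H
  | Name.mk I A a, Name.mk J B b =>
      (⨅ i : I, a i ⇨ ⨆ j : J, b j ⊓ eqV (A i) (B j)) ⊓
      (⨅ j : J, b j ⇨ ⨆ i : I, a i ⊓ eqV (A i) (B j))

/-- The truth value of `x ∈ y`. -/
def memV (x : Name.{u, v} H) : Name.{u, v} H → H
  | Name.mk J B b => ⨆ j : J, b j ⊓ eqV x (B j)

/-- Formulas of the language of set theory with free variables indexed by `Fin n`. A quantifier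
binds the new variable `0` and shifts the others up by one. -/
inductive SetFormula : ℕ → Type
  | mem {n : ℕ} (i j : Fin n) : SetFormula n
  | eq {n : ℕ} (i j : Fin n) : SetFormula n
  | bot {n : ℕ} : SetFormula n
  | and {n : ℕ} (φ ψ : SetFormula n) : SetFormula n
  | or {n : ℕ} (φ ψ : SetFormula n) : SetFormula n
  | imp {n : ℕ} (φ ψ : SetFormula n) : SetFormula n
  | all {n : ℕ} (φ : SetFormula (n + 1)) : SetFormula n
  | ex {n : ℕ} (φ : SetFormula (n + 1)) : SetFormula n

/-- The truth value of a formula under an assignment of names to its free variables. -/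
def SetFormula.value : {n : ℕ} → SetFormula n → (Fin n → Name.{u, v} H) → H
  | _, .mem i j, w => memV (w i) (w j)
  | _, .eq i j, w => eqV (w i) (w j)
  | _, .bot, _ => ⊥
  | _, .and φ ψ, w => φ.value w ⊓ ψ.value w
  | _, .or φ ψ, w => φ.value w ⊔ ψ.value w
  | _, .imp φ ψ, w => φ.value w ⇨ ψ.value w
  | _, .all φ, w => ⨅ x : Name.{u, v} H, φ.value (Matrix.vecCons x w)
  | _, .ex φ, w => ⨆ x : Name.{u, v} H, φ.value (Matrix.vecCons x w)

/-! The following are the truth values of the usual set-theoretic formulas: conjunction is `⊓`,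
disjunction is `⊔`, implication is `⇨`, negation is `ᶜ`, and the quantifiers over the model
are `⨅` and `⨆` over all names. -/

/-- Truth value of a biconditional. -/
def iffV (a b : H) : H := (a ⇨ b) ⊓ (b ⇨ a)

/-- `∀ x ∈ A, φ x`. -/
def allIn (A : Name.{u, v} H) (φ : Name.{u, v} H → H) : H :=
  ⨅ x : Name.{u, v} H, memV x A ⇨ φ x

/-- `∃ x ∈ A, φ x`. -/
def exIn (A : Name.{u, v} H) (φ : Name.{u, v} H → H) : H :=
  ⨆ x : Name.{u, v} H, memV x A ⊓ φ x

/-- `A ⊆ B`. -/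
def subsetV (A B : Name.{u, v} H) : H := allIn A fun x => memV x B

/-- `z = {x, y}`. -/
def isUPair (z x y : Name.{u, v} H) : H :=
  ⨅ w : Name.{u, v} H, iffV (memV w z) (eqV w x ⊔ eqV w y)

/-- `z = (x, y) = {{x}, {x, y}}`. -/
def isPair (z x y : Name.{u, v} H) : H :=
  ⨅ w : Name.{u, v} H, iffV (memV w z) (isUPair w x x ⊔ isUPair w x y)

/-- `(x, y) ∈ F`, that is, `F(x) = y` when `F` is a function. -/
def appV (F x y : Name.{u, v} H) : H :=
  ⨆ z : Name.{u, v} H, isPair z x y ⊓ memV z F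

/-- `F` is a function with domain `A`. -/
def isFunOn (F A : Name.{u, v} H) : H :=
  (allIn F fun z => exIn A fun x => ⨆ y : Name.{u, v} H, isPair z x y) ⊓
  (allIn A fun x => ⨆ y : Name.{u, v} H, appV F x y) ⊓
  (⨅ (x : Name.{u, v} H) (y : Name.{u, v} H) (y' : Name.{u, v} H),
    appV F x y ⊓ appV F x y' ⇨ eqV y y')

/-- `F` is a function from `A` to `B`. -/
def isFun (F A B : Name.{u, v} H) : H :=
  isFunOn F A ⊓
  (⨅ (x : Name.{u, v} H) (y : Name.{u, v} H), appV F x y ⇨ memV y B)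

/-- `R` is the range of `F`, where `F` is a function with domain `A`. -/
def isRange (R F A : Name.{u, v} H) : H :=
  ⨅ y : Name.{u, v} H, iffV (memV y R) (exIn A fun x => appV F x y)

/-- `n' = n ∪ {n}`. -/
def isSucc (n' n : Name.{u, v} H) : H :=
  ⨅ w : Name.{u, v} H, iffV (memV w n') (memV w n ⊔ eqV w n)

/-- The natural numbers of the model: the canonical name of the ground-model `ω`. -/
def omegaN : Name.{u, v} H := check PSet.omega

/-- The ordered pair `(x, y) = {{x}, {x, y}}` in the ground model. -/
def psPair (x y : PSet.{u}) : PSet.{u} := {{x}, {x, y}}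

/-- The graph `{((k, l), k * l) | k, l ∈ ω}` of multiplication in the ground model. -/
def mulGraph : PSet.{u} :=
  PSet.mk (ULift.{u} (ℕ × ℕ)) fun i =>
    psPair (psPair (PSet.ofNat i.down.1) (PSet.ofNat i.down.2))
      (PSet.ofNat (i.down.1 * i.down.2))

/-- `k * l < n`, for natural numbers `k`, `l`, `n` of the model. -/
def mulLt (k l n : Name.{u, v} H) : H :=
  ⨆ (q : Name.{u, v} H) (m : Name.{u, v} H),
    isPair q k l ⊓ appV (check mulGraph) q m ⊓ memV m n

/-- `x ≤ y`, for natural numbers (von Neumann ordinals) of the model. -/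
def leV (x y : Name.{u, v} H) : H := memV x y ⊔ eqV x y

/-- `A` is countable: it is the range of a function with domain the natural numbers. -/
def countableV (A : Name.{u, v} H) : H :=
  ⨆ h : Name.{u, v} H, isFunOn h omegaN ⊓ isRange A h omegaN

/-- The sequence `a` of natural numbers satisfies `lim a_n / n = 0`: for every `k` there is `N`
such that `k * a_n < n` for all `n ≥ N`. -/
def seqPseudoBounded (a : Name.{u, v} H) : H :=
  allIn omegaN fun k => exIn omegaN fun N => allIn omegaN fun n =>
    leV N n ⇨ ⨆ l : Name.{u, v} H, appV a n l ⊓ mulLt k l n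

/-- The set `A` of natural numbers is pseudo-bounded: every sequence of its members is. -/
def pseudoBounded (A : Name.{u, v} H) : H :=
  ⨅ a : Name.{u, v} H, isFun a omegaN A ⇨ seqPseudoBounded a

/-- The set `A` of natural numbers is bounded. -/
def boundedV (A : Name.{u, v} H) : H :=
  exIn omegaN fun B => allIn A fun x => leV x B

/-- The principle BD-ℕ: every countable pseudo-bounded set of natural numbers is bounded. -/
def bdN : H :=
  ⨅ A : Name.{u, v} H, subsetV A omegaN ⊓ countableV A ⊓ pseudoBounded A ⇨ boundedV A

/-- `a` is a function on the natural numbers with `a_0 = x₀` and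
`φ(a_n, a_{n+1})` for all `n`. -/
def isChain (φ : Name.{u, v} H → Name.{u, v} H → H) (x₀ a : Name.{u, v} H) : H :=
  isFunOn a omegaN ⊓ appV a (check ∅) x₀ ⊓
  (allIn omegaN fun n => ⨅ n' : Name.{u, v} H, isSucc n' n ⇨
    ⨆ (x : Name.{u, v} H) (y : Name.{u, v} H), appV a n x ⊓ appV a n' y ⊓ φ x y)

/-- Dependent choice over the whole model: if `∀ x ∃ y φ(x, y)`, then for every `x₀` there is a
sequence `a` with `a_0 = x₀` and `φ(a_n, a_{n+1})` for all `n`. -/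
def dcClass (φ : Name.{u, v} H → Name.{u, v} H → H) : H :=
  (⨅ x : Name.{u, v} H, ⨆ y : Name.{u, v} H, φ x y) ⇨
    ⨅ x₀ : Name.{u, v} H, ⨆ a : Name.{u, v} H, isChain φ x₀ a

/-- Dependent choice on sets: for every set `A`, if `∀ x ∈ A ∃ y ∈ A φ(x, y)`, then for every
`x₀ ∈ A` there is a sequence `a` of elements of `A` with `a_0 = x₀` and `φ(a_n, a_{n+1})` for
all `n`. -/
def dcSet (φ : Name.{u, v} H → Name.{u, v} H → H) : H :=
  ⨅ A : Name.{u, v} H,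
    (allIn A fun x => exIn A fun y => φ x y) ⇨
      allIn A fun x₀ => ⨆ a : Name.{u, v} H, isFun a omegaN A ⊓ isChain φ x₀ a

/-- The binary relation given by a formula `φ(x, y, w₀, …, w_{n-1})` with parameters `w`. -/
def relOf {n : ℕ} (φ : SetFormula (n + 2)) (w : Fin n → Name.{u, v} H)
    (x y : Name.{u, v} H) : H :=
  φ.value (Matrix.vecCons x (Matrix.vecCons y w))

end Semantics

/-! ### The space of functions with finite range -/

/-- The points of the space: functions from `ω` to `ω` with finite range. -/
def T : Type := {f : ℕ → ℕ // (Set.range f).Finite}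

/-- The data of a (nonempty) basic open set. -/
structure Cond where
  /-- the bounding sequence -/
  g : ℕ → ℕ
  /-- the length of the part that is fixed -/
  stem : ℕ
  unbounded : ∀ B : ℕ, ∃ n : ℕ, B < g n
  mono : ∀ m n : ℕ, stem ≤ m → m ≤ n → g m ≤ g n
  le_stem : ∀ i : ℕ, i < stem → g i ≤ g stem

/-- The basic open set given by a condition. -/
def Cond.toSet (p : Cond) : Set T :=
  {f : T | (∀ n : ℕ, n < p.stem → f.1 n = p.g n) ∧ (∀ n : ℕ, p.stem ≤ n → f.1 n ≤ p.g n)}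

instance : TopologicalSpace T := generateFrom (Set.range Cond.toSet)

theorem isOpen_value (n x : ℕ) : IsOpen {f : T | f.1 n = x} := by
  rw [isOpen_iff_forall_mem_open]
  intro f hf
  obtain ⟨B, hB⟩ := f.2.bddAbove
  have hB' : ∀ m, f.1 m ≤ B := fun m => hB ⟨m, rfl⟩
  let p : Cond :=
    { g := fun m => if m < n + 1 then f.1 m else B + m
      stem := n + 1
      unbounded := fun C => ⟨n + 1 + C, by
        rw [if_neg (by omega)]; omega⟩
      mono := fun a b ha hab => by
        rw [if_neg (by omega), if_neg (by omega)]; omega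
      le_stem := fun i hi => by
        have := hB' i
        rw [if_pos hi, if_neg (by omega)]; omega }
  refine ⟨p.toSet, ?_, isOpen_generateFrom_of_mem ⟨p, rfl⟩, ?_, ?_⟩
  · intro h hh
    have h1 : h.1 n = p.g n := hh.1 n (Nat.lt_succ_self n)
    have h2 : p.g n = f.1 n := if_pos (Nat.lt_succ_self n)
    exact (h1.trans h2).trans hf
  · intro m hm
    exact (if_pos hm).symm
  · intro m hm
    have h2 : p.g m = B + m := if_neg (not_lt.mpr hm)
    rw [h2]
    exact (hB' m).trans (Nat.le_add_right _ _)

/-- The open set of all `f` with `f n = x`. -/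
def valueOpen (n x : ℕ) : Opens T := ⟨{f : T | f.1 n = x}, isOpen_value n x⟩

/-- The full topological model over the space `T`. -/
abbrev Model : Type (u + 1) := Name.{u, 0} (Opens T)

/-- `T ⊩ φ`: the truth value of `φ` is the whole space. -/
def Forced (φ : Opens T) : Prop := φ = ⊤

/-- The point `f` of the space as a ground-model set: the graph `{(n, f n) | n ∈ ω}`. -/
def pointSet (f : T) : PSet.{u} :=
  PSet.mk (ULift.{u} ℕ) fun n => psPair (PSet.ofNat n.down) (PSet.ofNat (f.1 n.down))

/-- The open set `r` as a ground-model set, the set of its points. -/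
def openSet (r : Opens T) : PSet.{u} :=
  PSet.mk (ULift.{u} {f : T // f ∈ r}) fun f => pointSet f.down.1

/-- The generic term `{⟨r̂, r⟩ | r open}`. -/
def genericFilter : Model.{u} :=
  Name.mk (ULift.{u} (Opens T)) (fun r => check (openSet r.down)) (fun r => r.down)

/-- The generic `G` as a function: `(n, x)` belongs to it with truth value `{f | f n = x}`. -/
def genericFun : Model.{u} :=
  Name.mk (ULift.{u} (ℕ × ℕ))
    (fun i => check (psPair (PSet.ofNat i.down.1) (PSet.ofNat i.down.2)))
    (fun i => valueOpen i.down.1 i.down.2)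

/-- The range of the generic `G`. -/
def rngG : Model.{u} :=
  Name.mk (ULift.{u} (ℕ × ℕ))
    (fun i => check (PSet.ofNat i.down.2))
    (fun i => valueOpen i.down.1 i.down.2)

/-- `F` is the set of those `z` which belong to all points of some member of the generic term,
i.e. `F` is the function which the generic term determines. -/
def isGenericFun (F : Model.{u}) : Opens T :=
  ⨅ z : Model.{u}, iffV (memV z F)
    (exIn genericFilter fun r => allIn r fun f => memV z f)

end TopModel

namespace TopModel

open TopologicalSpace

/-! ### The algebra of names -/

section Semantics

variable {H : Type v} [Order.Frame H]

/-! A basic open set fixes finitely many values and afterwards imposes only bounds tending to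
infinity. Since a point has finite range, no neighbourhood of it decides a bound on the range of the
generic function: a value `B + 1` can be inserted far out (`boundedV_rngG`).

Pseudo-boundedness rests on compactness. On the functions bounded by a constant `B` the topology is
no finer than the product topology, so they form a compact set, and an open set containing them
contains all functions below some unbounded `H ≥ B` (`exists_boundSet_subset`). Let a condition `p`
force `a` to be a sequence in the range, and fix `k`. A function in `p` bounded by `(n - 1) / (k +
1)` lies in the truth value of `k * a_n < n`, because there `a_n` is one of its values. Hence so
does every function in `p` below some unbounded `H_n ≥ (n - 1) / (k + 1)`. These lower bounds tend
to infinity, so the pointwise infimum of the `H_n` is still unbounded, and a single neighbourhood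
serves all large `n`.

Dependent choice follows from the maximum principle: an existential statement has a name whose
instance attains its full truth value (`maximum_principle`). The space is a countable union of
images of second countable spaces, so open covers have countable subcovers. Basic sets are clopen,
so these can be made disjoint and names mixed along them. Witnesses are then iterated in the ground
model.

The calculus of names reduces quantifiers over members of a name, or over the natural numbers, to
infima and suprema over index types; extensionality of the predicates makes this possible. -/

theorem le_of_le_iSup {ι : Sort*} {c b : H} {p : ι → H} (h : c ≤ ⨆ i, p i)
    (k : ∀ i, c ⊓ p i ≤ b) : c ≤ b := by
  rw [← inf_eq_left.2 h, inf_iSup_eq]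
  exact iSup_le k

theorem le_of_le_sup {c b p q : H} (h : c ≤ p ⊔ q) (hp : c ⊓ p ≤ b) (hq : c ⊓ q ≤ b) :
    c ≤ b := by
  rw [← inf_eq_left.2 h, inf_sup_left]
  exact sup_le hp hq

theorem le_of_le_himp {c a b : H} (h : c ≤ a ⇨ b) (ha : c ≤ a) : c ≤ b :=
  (le_inf le_rfl ha).trans (le_himp_iff.1 h)

theorem iffV_self (a : H) : iffV a a = ⊤ := by simp [iffV]

/-- The index type of a name. -/
def Name.idx : Name.{u, v} H → Type u
  | .mk J _ _ => J

/-- The members of a name. -/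
def Name.elt : (x : Name.{u, v} H) → x.idx → Name.{u, v} H
  | .mk _ A _ => A

/-- The truth values attached to the members of a name. -/
def Name.val : (x : Name.{u, v} H) → x.idx → H
  | .mk _ _ a => a

theorem memV_eq (x y : Name.{u, v} H) : memV x y = ⨆ j, y.val j ⊓ eqV x (y.elt j) := by
  cases y; rfl

theorem eqV_symm (x y : Name.{u, v} H) : eqV x y = eqV y x := by
  induction x generalizing y with
  | mk I A a ih =>
    cases y
    rw [eqV, eqV, inf_comm]
    simp only [ih]

theorem eqV_eq (x y : Name.{u, v} H) : eqV x y =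
    (⨅ i, x.val i ⇨ memV (x.elt i) y) ⊓ (⨅ j, y.val j ⇨ memV (y.elt j) x) := by
  cases x; cases y
  rw [eqV]
  simp only [memV_eq, Name.val, Name.elt]
  congr 1
  simp only [eqV_symm]
  rfl

theorem eqV_self (x : Name.{u, v} H) : eqV x x = ⊤ := by
  induction x with
  | mk I A a ih =>
    rw [eqV, eq_top_iff]
    refine le_inf (le_iInf fun i => le_himp_iff.2 ?_) (le_iInf fun i => le_himp_iff.2 ?_) <;>
    exact le_iSup_of_le i (by simp [ih])

theorem le_memV_of_val {c : H} {x y : Name.{u, v} H} (i : x.idx) (h : c ≤ eqV x y)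
    (hi : c ≤ x.val i) : c ≤ memV (x.elt i) y := by
  rw [eqV_eq] at h
  exact le_of_le_himp ((h.trans inf_le_left).trans (iInf_le _ i)) hi

/-- Induction with the context `c` left free, since each unfolding of membership shrinks it. The
hypothesis concerns members of `x` only, so the second inclusion turns the equalities around before
using it. -/
theorem le_eqV_trans {c : H} {x y z : Name.{u, v} H} (h : c ≤ eqV x y) (k : c ≤ eqV y z) :
    c ≤ eqV x z := by
  induction x generalizing y z c with
  | mk I A a ih =>
    rw [eqV_eq]
    refine le_inf (le_iInf fun i => le_himp_iff.2 ?_) (le_iInf fun l => le_himp_iff.2 ?_)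
    · have h1 : c ⊓ a i ≤ memV (A i) y :=
        le_memV_of_val (x := Name.mk I A a) i (inf_le_of_left_le h) inf_le_right
      rw [memV_eq] at h1
      refine le_of_le_iSup h1 fun j => ?_
      have h2 := le_memV_of_val (c := c ⊓ a i ⊓ (y.val j ⊓ eqV (A i) (y.elt j))) j
        (inf_le_of_left_le (inf_le_of_left_le k)) (inf_le_of_right_le inf_le_left)
      rw [memV_eq] at h2 ⊢
      refine le_of_le_iSup h2 fun l => le_iSup_of_le l (le_inf
        (inf_le_of_right_le inf_le_left) (ih i (y := y.elt j) ?_ ?_))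
      · exact inf_le_of_left_le (inf_le_of_right_le inf_le_right)
      · exact inf_le_of_right_le inf_le_right
    · rw [eqV_symm _ y] at h
      rw [eqV_symm y z] at k
      have h1 : c ⊓ z.val l ≤ memV (z.elt l) y :=
        le_memV_of_val l (inf_le_of_left_le k) inf_le_right
      rw [memV_eq] at h1
      refine le_of_le_iSup h1 fun j => ?_
      have h2 := le_memV_of_val (c := c ⊓ z.val l ⊓ (y.val j ⊓ eqV (z.elt l) (y.elt j))) j
        (inf_le_of_left_le (inf_le_of_left_le h)) (inf_le_of_right_le inf_le_left)
      rw [memV_eq] at h2 ⊢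
      refine le_of_le_iSup h2 fun i => le_iSup_of_le i (le_inf
        (inf_le_of_right_le inf_le_left) ?_)
      refine (ih i (y := y.elt j) ?_ ?_).trans (eqV_symm _ _).le
      · exact (inf_le_of_right_le inf_le_right).trans (eqV_symm _ _).le
      · exact (inf_le_of_left_le (inf_le_of_right_le inf_le_right)).trans (eqV_symm _ _).le

/-! ### Extensional predicates -/

/-- A predicate on names respects the equality of the model. -/
def Ext (φ : Name.{u, v} H → H) : Prop := ∀ x y, eqV x y ⊓ φ x ≤ φ y

/-- A function on names respects the equality of the model. -/
def Cong (f : Name.{u, v} H → Name.{u, v} H) : Prop := ∀ x y, eqV x y ≤ eqV (f x) (f y)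

theorem Cong.id : Cong (H := H) fun x : Name.{u, v} H => x := fun _ _ => le_rfl

theorem Cong.const (a : Name.{u, v} H) : Cong fun _ : Name.{u, v} H => a := fun _ _ => by
  rw [eqV_self]; exact le_top

theorem Ext.le {φ : Name.{u, v} H → H} (hφ : Ext φ) {c : H} {x y : Name.{u, v} H}
    (h : c ≤ eqV x y) (hx : c ≤ φ x) : c ≤ φ y := (le_inf h hx).trans (hφ x y)

theorem Ext.congr {φ : Name.{u, v} H → H} (hφ : Ext φ) {x y : Name.{u, v} H}
    (h : eqV x y = ⊤) : φ x = φ y :=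
  le_antisymm (hφ.le (le_top.trans h.ge) le_rfl)
    (hφ.le (le_top.trans ((eqV_symm y x).trans h).ge) le_rfl)

theorem Ext.const (a : H) : Ext fun _ : Name.{u, v} H => a := fun _ _ => inf_le_right

theorem Ext.inf {φ ψ : Name.{u, v} H → H} (hφ : Ext φ) (hψ : Ext ψ) :
    Ext fun x => φ x ⊓ ψ x := fun _ _ =>
  le_inf (hφ.le inf_le_left (inf_le_of_right_le inf_le_left))
    (hψ.le inf_le_left (inf_le_of_right_le inf_le_right))

theorem Ext.sup {φ ψ : Name.{u, v} H → H} (hφ : Ext φ) (hψ : Ext ψ) :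
    Ext fun x => φ x ⊔ ψ x := fun x y => by
  rw [inf_sup_left]
  exact sup_le_sup (hφ x y) (hψ x y)

theorem Ext.himp {φ ψ : Name.{u, v} H → H} (hφ : Ext φ) (hψ : Ext ψ) :
    Ext fun x => φ x ⇨ ψ x := fun x y => by
  refine le_himp_iff.2 (hψ.le (x := x) (inf_le_of_left_le inf_le_left) ?_)
  refine le_of_le_himp (inf_le_of_left_le inf_le_right) (hφ.le (x := y) ?_ inf_le_right)
  rw [eqV_symm]
  exact inf_le_of_left_le inf_le_left

theorem Ext.iInf {ι : Sort*} {φ : Name.{u, v} H → ι → H} (hφ : ∀ i, Ext fun x => φ x i) :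
    Ext fun x => ⨅ i, φ x i := fun _ _ =>
  le_iInf fun i => (hφ i).le inf_le_left (inf_le_of_right_le (iInf_le _ i))

theorem Ext.iSup {ι : Sort*} {φ : Name.{u, v} H → ι → H} (hφ : ∀ i, Ext fun x => φ x i) :
    Ext fun x => ⨆ i, φ x i := fun x y => by
  rw [inf_iSup_eq]
  exact iSup_mono fun i => hφ i x y

theorem Ext.eqV {f g : Name.{u, v} H → Name.{u, v} H} (hf : Cong f) (hg : Cong g) :
    Ext fun x => eqV (f x) (g x) := fun x y => by
  refine le_eqV_trans (y := f x) ?_ (le_eqV_trans (y := g x) inf_le_right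
    (inf_le_of_left_le (hg x y)))
  exact (inf_le_of_left_le (hf x y)).trans (eqV_symm _ _).le

theorem Ext.memV_left (a : Name.{u, v} H) : Ext fun x => memV x a := by
  simp only [memV_eq]
  exact Ext.iSup fun _ => (Ext.const _).inf (Ext.eqV Cong.id (Cong.const _))

theorem Ext.memV_right (a : Name.{u, v} H) : Ext fun x => memV a x := fun x y => by
  change _ ⊓ memV a x ≤ _
  refine le_of_le_iSup (b := memV a y) (inf_le_right.trans (memV_eq a x).le) fun i => ?_
  refine (Ext.memV_left y).le (x := x.elt i) ?_ (le_memV_of_val i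
    (inf_le_of_left_le inf_le_left) (inf_le_of_right_le inf_le_left))
  exact (inf_le_of_right_le inf_le_right).trans (eqV_symm _ _).le

theorem Ext.memV {f g : Name.{u, v} H → Name.{u, v} H} (hf : Cong f) (hg : Cong g) :
    Ext fun x => memV (f x) (g x) := fun x y =>
  (Ext.memV_left _).le (inf_le_of_left_le (hf x y))
    ((Ext.memV_right _).le (inf_le_of_left_le (hg x y)) inf_le_right)

theorem Ext.allIn {f : Name.{u, v} H → Name.{u, v} H}
    {φ : Name.{u, v} H → Name.{u, v} H → H} (hf : Cong f) (hφ : ∀ z, Ext fun x => φ x z) :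
    Ext fun x => allIn (f x) (φ x) :=
  Ext.iInf fun z => (Ext.memV (Cong.const z) hf).himp (hφ z)

theorem Ext.exIn {f : Name.{u, v} H → Name.{u, v} H}
    {φ : Name.{u, v} H → Name.{u, v} H → H} (hf : Cong f) (hφ : ∀ z, Ext fun x => φ x z) :
    Ext fun x => exIn (f x) (φ x) :=
  Ext.iSup fun z => (Ext.memV (Cong.const z) hf).inf (hφ z)

/-- The context `c` varies so that the induction can pass under implications, whose premise is
transported in the opposite direction. This supplies the extensionality that the maximum principle
needs. -/
theorem SetFormula.value_congr {n : ℕ} (φ : SetFormula n) {w w' : Fin n → Name.{u, v} H} {c : H}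
    (h : ∀ i, c ≤ eqV (w i) (w' i)) (hw : c ≤ φ.value w) : c ≤ φ.value w' := by
  induction φ generalizing c with
  | mem i j => exact (Ext.memV_left _).le (h i) ((Ext.memV_right _).le (h j) hw)
  | eq i j =>
    refine le_eqV_trans ?_ (le_eqV_trans hw (h j))
    rw [eqV_symm]
    exact h i
  | bot => exact hw
  | and φ ψ hφ hψ =>
    exact le_inf (hφ h (hw.trans inf_le_left)) (hψ h (hw.trans inf_le_right))
  | or φ ψ hφ hψ =>
    exact le_of_le_sup hw
      (le_sup_of_le_left (hφ (fun i => inf_le_of_left_le (h i)) inf_le_right))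
      (le_sup_of_le_right (hψ (fun i => inf_le_of_left_le (h i)) inf_le_right))
  | imp φ ψ hφ hψ =>
    refine le_himp_iff.2 (hψ (fun i => inf_le_of_left_le (h i))
      (le_of_le_himp (inf_le_of_left_le hw) (hφ (fun i => ?_) inf_le_right)))
    rw [eqV_symm]
    exact inf_le_of_left_le (h i)
  | all φ hφ =>
    refine le_iInf fun x => hφ (fun i => ?_) (hw.trans (iInf_le _ x))
    refine Fin.cases ?_ (fun i => h i) i
    exact le_top.trans (eqV_self x).ge
  | ex φ hφ =>
    refine le_of_le_iSup hw fun x => le_iSup_of_le x (hφ (fun i => ?_) inf_le_right)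
    refine Fin.cases ?_ (fun i => inf_le_of_left_le (h i)) i
    exact le_top.trans (eqV_self x).ge

theorem relOf_ext_right {n : ℕ} (φ : SetFormula (n + 2)) (w : Fin n → Name.{u, v} H)
    (x : Name.{u, v} H) : Ext (relOf φ w x) := fun y y' => by
  refine φ.value_congr (fun i => ?_) inf_le_right
  refine Fin.cases ?_ (fun i => Fin.cases ?_ (fun i => ?_) i) i
  · exact le_top.trans (eqV_self x).ge
  · exact inf_le_left
  · exact le_top.trans (eqV_self (w i)).ge

/-! ### Bounded quantifiers and extensionality -/

/-- This one-point rule and its dual below collapse quantifiers over all names. -/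
theorem iSup_eqV_inf {φ : Name.{u, v} H → H} (hφ : Ext φ) (a : Name.{u, v} H) :
    ⨆ z, eqV z a ⊓ φ z = φ a :=
  le_antisymm (iSup_le fun z => hφ z a) (le_iSup_of_le a (by rw [eqV_self, top_inf_eq]))

theorem iInf_eqV_himp {φ : Name.{u, v} H → H} (hφ : Ext φ) (a : Name.{u, v} H) :
    ⨅ z, (eqV z a ⇨ φ z) = φ a := by
  refine le_antisymm ((iInf_le _ a).trans (by rw [eqV_self, top_himp])) (le_iInf fun z => ?_)
  refine le_himp_iff.2 (hφ.le (x := a) ?_ inf_le_left)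
  rw [eqV_symm]
  exact inf_le_right

theorem allIn_eq {φ : Name.{u, v} H → H} (hφ : Ext φ) (A : Name.{u, v} H) :
    allIn A φ = ⨅ i, A.val i ⇨ φ (A.elt i) := by
  simp only [allIn, memV_eq, iSup_himp_eq]
  rw [iInf_comm]
  refine iInf_congr fun i => ?_
  rw [← iInf_eqV_himp (φ := fun z => A.val i ⇨ φ z) ((Ext.const _).himp hφ)]
  simp only [himp_himp, inf_comm]

theorem exIn_eq {φ : Name.{u, v} H → H} (hφ : Ext φ) (A : Name.{u, v} H) :
    exIn A φ = ⨆ i, A.val i ⊓ φ (A.elt i) := by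
  simp only [exIn, memV_eq, iSup_inf_eq]
  rw [iSup_comm]
  refine iSup_congr fun i => ?_
  rw [← iSup_eqV_inf (φ := fun z => A.val i ⊓ φ z) ((Ext.const _).inf hφ)]
  exact iSup_congr fun z => by ac_rfl

/-- Notions defined by a membership condition, such as pairs and successors, thereby become equality
with an explicit name. -/
theorem eqV_eq_iInf_iffV (x y : Name.{u, v} H) :
    eqV x y = ⨅ w, iffV (memV w x) (memV w y) := by
  rw [eqV_eq, ← allIn_eq (Ext.memV_left y), ← allIn_eq (Ext.memV_left x), allIn, allIn,
    ← iInf_inf_eq]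
  rfl

theorem eqV_eq_top {x y : Name.{u, v} H} (h : ∀ w, memV w x = memV w y) : eqV x y = ⊤ := by
  simp [eqV_eq_iInf_iffV, h, iffV_self]

theorem eqV_congr_right {a b : Name.{u, v} H} (h : eqV a b = ⊤) (w : Name.{u, v} H) :
    eqV w a = eqV w b := (Ext.eqV (Cong.const w) Cong.id).congr h

/-! ### Pairs and successors -/

/-- The unordered pair of two names. -/
def upairN (x y : Name.{u, v} H) : Name.{u, v} H :=
  Name.mk (ULift Bool) (fun b => cond b.down x y) fun _ => ⊤

/-- The ordered pair of two names. -/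
def pairN (x y : Name.{u, v} H) : Name.{u, v} H := upairN (upairN x x) (upairN x y)

/-- The successor of a name. -/
def succN (x : Name.{u, v} H) : Name.{u, v} H :=
  Name.mk (Option x.idx) (fun o => o.elim x x.elt) (fun o => o.elim ⊤ x.val)

theorem memV_upairN (w x y : Name.{u, v} H) : memV w (upairN x y) = eqV w x ⊔ eqV w y := by
  rw [upairN, memV]
  refine le_antisymm (iSup_le ?_) (sup_le (le_iSup_of_le ⟨true⟩ ?_) (le_iSup_of_le ⟨false⟩ ?_))
  · rintro ⟨_ | _⟩ <;> simp
  · simp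
  · simp

theorem memV_succN (w x : Name.{u, v} H) : memV w (succN x) = memV w x ⊔ eqV w x := by
  rw [succN, memV, iSup_option, sup_comm, memV_eq w x]
  simp

theorem isUPair_eq (z x y : Name.{u, v} H) : isUPair z x y = eqV z (upairN x y) := by
  simp only [isUPair, eqV_eq_iInf_iffV z, memV_upairN]

theorem isPair_eq (z x y : Name.{u, v} H) : isPair z x y = eqV z (pairN x y) := by
  simp only [isPair, eqV_eq_iInf_iffV z, pairN, memV_upairN, isUPair_eq]

theorem isSucc_eq (z x : Name.{u, v} H) : isSucc z x = eqV z (succN x) := by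
  simp only [isSucc, eqV_eq_iInf_iffV z, memV_succN]

theorem appV_eq (F x y : Name.{u, v} H) : appV F x y = memV (pairN x y) F := by
  simp only [appV, isPair_eq]
  exact iSup_eqV_inf (Ext.memV_left F) _

theorem le_eqV_upairN {c : H} {x y x' y' : Name.{u, v} H} (hx : c ≤ eqV x x')
    (hy : c ≤ eqV y y') : c ≤ eqV (upairN x y) (upairN x' y') := by
  rw [eqV_eq]
  refine le_inf (le_iInf ?_) (le_iInf ?_) <;> rintro ⟨_ | _⟩ <;>
    refine le_himp_iff.2 (inf_le_of_left_le ?_) <;> rw [memV_upairN]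
  · exact le_sup_of_le_right hy
  · exact le_sup_of_le_left hx
  · exact le_sup_of_le_right (hy.trans (eqV_symm _ _).le)
  · exact le_sup_of_le_left (hx.trans (eqV_symm _ _).le)

theorem le_upairN_fst {c : H} {x y x' y' : Name.{u, v} H}
    (h : c ≤ eqV (upairN x y) (upairN x' y')) : c ≤ eqV x x' ⊔ eqV x y' := by
  rw [← memV_upairN]
  refine (Ext.memV_right x).le h ?_
  rw [memV_upairN, eqV_self, top_sup_eq]
  exact le_top

theorem upairN_comm (x y : Name.{u, v} H) : eqV (upairN x y) (upairN y x) = ⊤ :=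
  eqV_eq_top fun w => by rw [memV_upairN, memV_upairN, sup_comm]

theorem le_upairN_snd {c : H} {x y x' y' : Name.{u, v} H}
    (h : c ≤ eqV (upairN x y) (upairN x' y')) : c ≤ eqV y x' ⊔ eqV y y' :=
  le_upairN_fst (le_eqV_trans (le_top.trans (upairN_comm y x).ge) h)

theorem le_pairN_fst {c : H} {x y x' y' : Name.{u, v} H}
    (h : c ≤ eqV (pairN x y) (pairN x' y')) : c ≤ eqV x x' := by
  refine le_of_le_sup (le_upairN_fst h) ?_ ?_
  · simpa using le_upairN_fst (c := c ⊓ eqV (upairN x x) (upairN x' x')) inf_le_right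
  · rw [eqV_symm x x']
    simpa using le_upairN_fst (c := c ⊓ eqV (upairN x x) (upairN x' y'))
      (inf_le_right.trans (eqV_symm _ _).le)

/-- Kuratowski's argument without excluded middle: the disjunctions come from membership in
unordered pairs, and the one critical case closes by the chain `y = x' = x = y'`. -/
theorem le_pairN_snd {c : H} {x y x' y' : Name.{u, v} H}
    (h : c ≤ eqV (pairN x y) (pairN x' y')) : c ≤ eqV y y' := by
  have hx := le_pairN_fst h
  have h1 : c ≤ eqV y x' ⊔ eqV y y' := by
    refine le_of_le_sup (le_upairN_snd h) ?_ (le_upairN_snd inf_le_right)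
    exact (le_upairN_snd inf_le_right).trans (by simp)
  have h2 : c ≤ eqV y' x ⊔ eqV y' y := by
    refine le_of_le_sup (le_upairN_snd (h.trans (eqV_symm _ _).le)) ?_
      (le_upairN_snd inf_le_right)
    exact (le_upairN_snd inf_le_right).trans (by simp)
  refine le_of_le_sup h1 ?_ inf_le_right
  refine le_of_le_sup (inf_le_of_left_le h2) ?_ (inf_le_right.trans (eqV_symm _ _).le)
  refine le_eqV_trans (y := x') (inf_le_of_left_le inf_le_right) ?_
  refine le_eqV_trans (y := x) ?_ (inf_le_right.trans (eqV_symm _ _).le)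
  exact inf_le_of_left_le (inf_le_of_left_le (hx.trans (eqV_symm _ _).le))

theorem eqV_pairN (x y x' y' : Name.{u, v} H) :
    eqV (pairN x y) (pairN x' y') = eqV x x' ⊓ eqV y y' :=
  le_antisymm (le_inf (le_pairN_fst le_rfl) (le_pairN_snd le_rfl))
    (le_eqV_upairN (le_eqV_upairN inf_le_left inf_le_left)
      (le_eqV_upairN inf_le_left inf_le_right))

theorem Cong.pairN {f g : Name.{u, v} H → Name.{u, v} H} (hf : Cong f) (hg : Cong g) :
    Cong fun x => pairN (f x) (g x) := fun x y => by
  rw [eqV_pairN]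
  exact le_inf (hf x y) (hg x y)

theorem Ext.isPair {f g h : Name.{u, v} H → Name.{u, v} H} (hf : Cong f) (hg : Cong g)
    (hh : Cong h) : Ext fun x => isPair (f x) (g x) (h x) := by
  simp only [isPair_eq]
  exact Ext.eqV hf (hg.pairN hh)

theorem Ext.appV {f g h : Name.{u, v} H → Name.{u, v} H} (hf : Cong f) (hg : Cong g)
    (hh : Cong h) : Ext fun x => appV (f x) (g x) (h x) := by
  simp only [appV_eq]
  exact Ext.memV (hg.pairN hh) hf

theorem Ext.leV {f g : Name.{u, v} H → Name.{u, v} H} (hf : Cong f) (hg : Cong g) :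
    Ext fun x => leV (f x) (g x) := (Ext.memV hf hg).sup (Ext.eqV hf hg)

theorem Ext.mulLt {f g h : Name.{u, v} H → Name.{u, v} H} (hf : Cong f) (hg : Cong g)
    (hh : Cong h) : Ext fun x => mulLt (f x) (g x) (h x) :=
  Ext.iSup fun _ => Ext.iSup fun _ => ((Ext.isPair (Cong.const _) hf hg).inf
    (Ext.const _)).inf (Ext.memV (Cong.const _) hh)

theorem Cong.succN : Cong (H := H) fun x : Name.{u, v} H => succN x := fun x y => by
  change _ ≤ TopModel.eqV (TopModel.succN x) (TopModel.succN y)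
  rw [eqV_eq_iInf_iffV (TopModel.succN x)]
  refine le_iInf fun w => ?_
  rw [memV_succN, memV_succN]
  have hE : Ext fun z => memV w z ⊔ eqV w z :=
    (Ext.memV_right w).sup (Ext.eqV (Cong.const w) Cong.id)
  exact le_inf (le_himp_iff.2 (hE x y))
    (le_himp_iff.2 (hE.le (inf_le_left.trans (eqV_symm _ _).le) inf_le_right))

/-! ### Ground-model sets -/

theorem memV_check (w : Name.{u, v} H) (x : PSet.{u}) :
    memV w (check x) = ⨆ i, eqV w (check (x.Func i)) := by
  cases x
  simp [check, memV]

theorem eqV_check_of_equiv {x y : PSet.{u}} (h : x.Equiv y) :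
    eqV (check x : Name.{u, v} H) (check y) = ⊤ := by
  induction x generalizing y with
  | mk I A ih =>
    cases y with
    | mk J B =>
      rw [check, check, eqV, eq_top_iff]
      refine le_inf (le_iInf fun i => le_himp_iff.2 ?_) (le_iInf fun j => le_himp_iff.2 ?_)
      · obtain ⟨j, hj⟩ := h.1 i
        exact le_iSup_of_le j (by simp [ih i hj])
      · obtain ⟨i, hi⟩ := h.2 j
        exact le_iSup_of_le i (by simp [ih i hi])

/-- With the preceding lemma, equality of canonical names is two-valued, so arithmetic facts
transfer from the ground model. -/
theorem eqV_check_of_not_equiv {x y : PSet.{u}} (h : ¬ x.Equiv y) :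
    eqV (check x : Name.{u, v} H) (check y) = ⊥ := by
  induction x generalizing y with
  | mk I A ih =>
    cases y with
    | mk J B =>
      rw [check, check, eqV, eq_bot_iff]
      rcases not_and_or.1 h with h | h
      · push Not at h
        obtain ⟨i, hi⟩ := h
        refine inf_le_of_left_le ((iInf_le _ i).trans ?_)
        simp [ih i (hi _)]
      · push Not at h
        obtain ⟨j, hj⟩ := h
        refine inf_le_of_right_le ((iInf_le _ j).trans ?_)
        simp [ih _ (hj _)]

theorem memV_check_of_mem {x y : PSet.{u}} (h : x ∈ y) :
    memV (check x : Name.{u, v} H) (check y) = ⊤ := by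
  obtain ⟨i, hi⟩ := h
  rw [memV_check, eq_top_iff]
  exact le_iSup_of_le i (eqV_check_of_equiv hi).ge

theorem memV_check_of_not_mem {x y : PSet.{u}} (h : x ∉ y) :
    memV (check x : Name.{u, v} H) (check y) = ⊥ := by
  rw [memV_check, eq_bot_iff]
  exact iSup_le fun i => (eqV_check_of_not_equiv fun hi => h ⟨i, hi⟩).le

theorem memV_check_empty (w : Name.{u, v} H) : memV w (check ∅) = ⊥ := by
  rw [memV_check, iSup_of_empty]

theorem memV_check_insert (w : Name.{u, v} H) (x y : PSet.{u}) :
    memV w (check (insert x y)) = eqV w (check x) ⊔ memV w (check y) := by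
  rw [memV_check, memV_check]
  exact iSup_option _

theorem eqV_check_upair (x y : PSet.{u}) :
    eqV (check {x, y} : Name.{u, v} H) (upairN (check x) (check y)) = ⊤ :=
  eqV_eq_top fun w => by
    rw [memV_check_insert, memV_upairN, ← insert_empty_eq, memV_check_insert, memV_check_empty,
      sup_bot_eq]

theorem eqV_check_singleton (x : PSet.{u}) :
    eqV (check {x} : Name.{u, v} H) (upairN (check x) (check x)) = ⊤ :=
  eqV_eq_top fun w => by
    rw [memV_upairN, ← insert_empty_eq, memV_check_insert, memV_check_empty, sup_bot_eq, sup_idem]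

theorem eqV_check_psPair (x y : PSet.{u}) :
    eqV (check (psPair x y) : Name.{u, v} H) (pairN (check x) (check y)) = ⊤ := by
  refine top_unique (le_eqV_trans (eqV_check_upair _ _).ge ?_)
  exact le_eqV_upairN (eqV_check_singleton x).ge (eqV_check_upair x y).ge

/-! ### Natural numbers -/

theorem _root_.PSet.mem_ofNat {x : PSet.{u}} {n : ℕ} :
    x ∈ PSet.ofNat.{u} n ↔ ∃ m < n, x.Equiv (PSet.ofNat.{u} m) := by
  induction n with
  | zero => simp [PSet.ofNat]
  | succ n ih =>
    simp only [PSet.ofNat, PSet.mem_insert_iff, ih]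
    constructor
    · rintro (h | ⟨m, hm, h⟩)
      · exact ⟨n, n.lt_succ_self, h⟩
      · exact ⟨m, by omega, h⟩
    · rintro ⟨m, hm, h⟩
      rcases Nat.lt_succ_iff_lt_or_eq.1 hm with hm | rfl
      · exact Or.inr ⟨m, hm, h⟩
      · exact Or.inl h

theorem _root_.PSet.ofNat_mem_ofNat_of_lt {m n : ℕ} (h : m < n) :
    (PSet.ofNat m : PSet.{u}) ∈ (PSet.ofNat n : PSet.{u}) :=
  PSet.mem_ofNat.2 ⟨m, h, PSet.Equiv.rfl⟩

theorem _root_.PSet.ofNat_equiv_ofNat {m n : ℕ} :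
    (PSet.ofNat m : PSet.{u}).Equiv (PSet.ofNat.{u} n) ↔ m = n := by
  refine ⟨fun h => ?_, fun h => h ▸ PSet.Equiv.rfl⟩
  rcases lt_trichotomy m n with hl | hl | hl
  · exact absurd ((PSet.Mem.congr_left h).1 (PSet.ofNat_mem_ofNat_of_lt hl)) (PSet.mem_irrefl _)
  · exact hl
  · exact absurd ((PSet.Mem.congr_right h).1 (PSet.ofNat_mem_ofNat_of_lt hl)) (PSet.mem_irrefl _)

theorem _root_.PSet.ofNat_mem_ofNat {m n : ℕ} :
    (PSet.ofNat m : PSet.{u}) ∈ (PSet.ofNat n : PSet.{u}) ↔ m < n := by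
  refine ⟨fun h => ?_, PSet.ofNat_mem_ofNat_of_lt⟩
  obtain ⟨k, hk, e⟩ := PSet.mem_ofNat.1 h
  rwa [PSet.ofNat_equiv_ofNat.1 e]

/-- The canonical name of a natural number. -/
abbrev natN (n : ℕ) : Name.{u, v} H := check (PSet.ofNat.{u} n)

theorem eqV_natN_of_ne {m n : ℕ} (h : m ≠ n) : eqV (natN m : Name.{u, v} H) (natN n) = ⊥ :=
  eqV_check_of_not_equiv fun e => h (PSet.ofNat_equiv_ofNat.1 e)

theorem memV_natN_of_lt {m n : ℕ} (h : m < n) : memV (natN m : Name.{u, v} H) (natN n) = ⊤ :=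
  memV_check_of_mem (PSet.ofNat_mem_ofNat.2 h)

theorem memV_natN_of_le {m n : ℕ} (h : n ≤ m) : memV (natN m : Name.{u, v} H) (natN n) = ⊥ :=
  memV_check_of_not_mem fun e => absurd (PSet.ofNat_mem_ofNat.1 e) (not_lt.2 h)

theorem leV_natN_of_lt {m n : ℕ} (h : n < m) : leV (natN m : Name.{u, v} H) (natN n) = ⊥ := by
  rw [leV, memV_natN_of_le h.le, eqV_natN_of_ne h.ne', sup_bot_eq]

theorem eqV_natN_succ (n : ℕ) :
    eqV (natN (n + 1) : Name.{u, v} H) (succN (natN n)) = ⊤ :=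
  eqV_eq_top fun w => by
    rw [natN, PSet.ofNat, memV_check_insert, memV_succN, sup_comm]

theorem memV_omegaN (w : Name.{u, v} H) : memV w omegaN = ⨆ n : ℕ, eqV w (natN n) := by
  rw [omegaN, memV_check]
  exact Equiv.ulift.iSup_congr fun _ => rfl

theorem allIn_omegaN {φ : Name.{u, v} H → H} (hφ : Ext φ) :
    allIn omegaN φ = ⨅ n : ℕ, φ (natN n) := by
  simp only [allIn, memV_omegaN, iSup_himp_eq]
  rw [iInf_comm]
  exact iInf_congr fun n => iInf_eqV_himp hφ _

theorem exIn_omegaN {φ : Name.{u, v} H → H} (hφ : Ext φ) :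
    exIn omegaN φ = ⨆ n : ℕ, φ (natN n) := by
  simp only [exIn, memV_omegaN, iSup_inf_eq]
  rw [iSup_comm]
  exact iSup_congr fun n => iSup_eqV_inf hφ _

theorem mulLt_natN {k l n : ℕ} (h : k * l < n) :
    mulLt (natN k : Name.{u, v} H) (natN l) (natN n) = ⊤ := by
  rw [mulLt, eq_top_iff]
  refine le_iSup_of_le (pairN (natN k) (natN l)) (le_iSup_of_le (natN (k * l)) ?_)
  rw [isPair_eq, eqV_self, memV_natN_of_lt h, appV_eq, memV_check, top_inf_eq, inf_top_eq]
  refine le_iSup_of_le ⟨(k, l)⟩ ?_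
  refine le_eqV_trans (le_eqV_upairN ?_ ?_)
    ((eqV_symm _ _).trans (eqV_check_psPair _ _)).ge
  · refine le_eqV_upairN ?_ ?_ <;> exact ((eqV_symm _ _).trans (eqV_check_psPair _ _)).ge
  · exact le_eqV_upairN ((eqV_symm _ _).trans (eqV_check_psPair _ _)).ge (eqV_self _).ge

/-! ### Functions on the natural numbers -/

/-- A name whose members are pairs with a natural number as first component is a function on the
natural numbers if the predicate giving its values is total and single-valued. -/
theorem isFunOn_omegaN {F : Name.{u, v} H} {P : ℕ → Name.{u, v} H → H}
    (happ : ∀ x y, appV F x y = ⨆ n, eqV x (natN n) ⊓ P n y)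
    (hpair : ∀ i, F.val i ≤ ⨆ (n : ℕ) (y), isPair (F.elt i) (natN n) y)
    (htotal : ∀ n, ⨆ y, P n y = ⊤) (huniq : ∀ n y y', P n y ⊓ P n y' ≤ eqV y y') :
    isFunOn F omegaN = ⊤ := by
  refine top_unique (le_inf (le_inf ?_ ?_) ?_)
  · rw [allIn_eq (Ext.exIn (Cong.const _) fun x => Ext.iSup fun y =>
      Ext.isPair Cong.id (Cong.const x) (Cong.const y))]
    refine le_iInf fun i => le_himp_iff.2 (inf_le_of_right_le ?_)
    rw [exIn_omegaN (Ext.iSup fun y => Ext.isPair (Cong.const _) Cong.id (Cong.const y))]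
    exact hpair i
  · rw [allIn_omegaN (Ext.iSup fun y => Ext.appV (Cong.const _) Cong.id (Cong.const y))]
    refine le_iInf fun n => (htotal n).ge.trans (iSup_mono fun y => ?_)
    rw [happ]
    exact le_iSup_of_le n (by rw [eqV_self, top_inf_eq])
  · refine le_iInf fun x => le_iInf fun y => le_iInf fun y' => le_himp_iff.2 ?_
    refine inf_le_of_right_le ?_
    rw [happ, happ, iSup_inf_iSup]
    refine iSup_le fun ⟨n, m⟩ => ?_
    obtain rfl | hnm := eq_or_ne n m
    · refine le_trans (le_inf ?_ ?_) (huniq n y y')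
      · exact inf_le_of_left_le inf_le_right
      · exact inf_le_of_right_le inf_le_right
    · refine le_trans ?_ bot_le
      rw [← eqV_natN_of_ne (H := H) hnm]
      exact le_eqV_trans (y := x) (inf_le_of_left_le (inf_le_left.trans (eqV_symm _ _).le))
        (inf_le_of_right_le inf_le_left)

/-- The name of the sequence with given terms. -/
def seqN (s : ℕ → Name.{u, v} H) : Name.{u, v} H :=
  Name.mk (ULift ℕ) (fun n => pairN (natN n.down) (s n.down)) fun _ => ⊤

theorem appV_seqN (s : ℕ → Name.{u, v} H) (x y : Name.{u, v} H) :
    appV (seqN s) x y = ⨆ n, eqV x (natN n) ⊓ eqV y (s n) := by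
  rw [appV_eq, seqN, memV]
  refine Equiv.ulift.iSup_congr fun n => ?_
  rw [top_inf_eq, eqV_pairN]
  rfl

theorem appV_seqN_natN (s : ℕ → Name.{u, v} H) (n : ℕ) : appV (seqN s) (natN n) (s n) = ⊤ := by
  rw [appV_seqN, eq_top_iff]
  exact le_iSup_of_le n (by rw [eqV_self, eqV_self, top_inf_eq])

theorem isFunOn_seqN (s : ℕ → Name.{u, v} H) : isFunOn (seqN s) omegaN = ⊤ := by
  refine isFunOn_omegaN (P := fun n y => eqV y (s n)) (appV_seqN s) ?_ ?_ ?_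
  · rintro ⟨n⟩
    refine le_iSup_of_le n (le_iSup_of_le (s n) ?_)
    rw [isPair_eq]
    exact (eqV_self (pairN (natN n) (s n))).ge.trans' le_top
  · exact fun n => top_unique (le_iSup_of_le (s n) (eqV_self _).ge)
  · exact fun n y y' => le_eqV_trans inf_le_left (inf_le_right.trans (eqV_symm _ _).le)

theorem isFun_seqN {c : H} {s : ℕ → Name.{u, v} H} {A : Name.{u, v} H}
    (h : ∀ n, c ≤ memV (s n) A) : c ≤ isFun (seqN s) omegaN A := by
  refine le_inf (by rw [isFunOn_seqN]; exact le_top) (le_iInf fun x => le_iInf fun y => ?_)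
  rw [appV_seqN]
  refine le_himp_iff.2 (le_of_le_iSup inf_le_right fun n => ?_)
  refine (Ext.memV_left A).le (x := s n) ?_ (inf_le_of_left_le (inf_le_of_left_le (h n)))
  exact (inf_le_of_right_le inf_le_right).trans (eqV_symm _ _).le

theorem isChain_seqN {c : H} {s : ℕ → Name.{u, v} H} {φ : Name.{u, v} H → Name.{u, v} H → H}
    (h : ∀ n, c ≤ φ (s n) (s (n + 1))) : c ≤ isChain φ (s 0) (seqN s) := by
  refine le_inf (le_inf (by rw [isFunOn_seqN]; exact le_top) ?_) ?_
  · exact le_top.trans (appV_seqN_natN s 0).ge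
  · simp only [isSucc_eq]
    rw [allIn_omegaN (Ext.iInf fun n' => (Ext.eqV (Cong.const _) Cong.succN).himp
      (Ext.iSup fun x => Ext.iSup fun y => ((Ext.appV (Cong.const _) Cong.id (Cong.const _)).inf
        (Ext.const _)).inf (Ext.const _)))]
    refine le_iInf fun n => ?_
    -- The successor is unique up to equality, so the quantifier is evaluated at `succN (natN n)`,
    -- which equals `natN (n + 1)`.
    rw [iInf_eqV_himp (φ := fun n' => ⨆ (x) (y), appV (seqN s) (natN n) x ⊓
      appV (seqN s) n' y ⊓ φ x y) (Ext.iSup fun x => Ext.iSup fun y =>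
        ((Ext.const _).inf (Ext.appV (Cong.const _) Cong.id (Cong.const _))).inf (Ext.const _))]
    refine le_iSup_of_le (s n) (le_iSup_of_le (s (n + 1)) (le_inf (le_inf ?_ ?_) (h n)))
    · exact le_top.trans (appV_seqN_natN s n).ge
    · refine (Ext.appV (Cong.const _) Cong.id (Cong.const _)).le
        (le_top.trans (eqV_natN_succ n).ge) (le_top.trans (appV_seqN_natN s (n + 1)).ge)

/-! ### Dependent choice from the maximum principle -/

theorem dcClass_eq_top
    (hmax : ∀ φ : Name.{u, v} H → H, Ext φ → ∃ y, ⨆ z, φ z ≤ φ y)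
    {φ : Name.{u, v} H → Name.{u, v} H → H} (hφ : ∀ x, Ext (φ x)) : dcClass φ = ⊤ := by
  choose F hF using fun x => hmax (φ x) (hφ x)
  refine top_unique (le_himp_iff.2 (le_iInf fun x₀ => ?_))
  refine inf_le_of_right_le (le_iSup_of_le (seqN fun n => F^[n] x₀) ?_)
  refine isChain_seqN (s := fun n => F^[n] x₀) fun n => ?_
  rw [Function.iterate_succ_apply']
  exact (iInf_le _ _).trans (hF _)

theorem dcSet_eq_top
    (hmax : ∀ φ : Name.{u, v} H → H, Ext φ → ∃ y, ⨆ z, φ z ≤ φ y)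
    {φ : Name.{u, v} H → Name.{u, v} H → H} (hφ : ∀ x, Ext (φ x)) : dcSet φ = ⊤ := by
  refine top_unique (le_iInf fun A => le_himp_iff.2 (le_iInf fun x₀ => le_himp_iff.2 ?_))
  choose F hF using fun x => hmax (fun y => memV y A ⊓ φ x y) ((Ext.memV_left A).inf (hφ x))
  set U := ⊤ ⊓ (allIn A fun x => exIn A fun y => φ x y) ⊓ memV x₀ A
  -- Here `F x` is a good witness only where `x` lies in `A`, so membership of the iterates is
  -- carried along below `U`.
  have hstep : ∀ x, U ≤ memV x A → U ≤ memV (F x) A ⊓ φ x (F x) := fun x hx =>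
    (le_of_le_himp ((inf_le_of_left_le inf_le_right).trans (iInf_le _ x)) hx).trans (hF x)
  have hmem : ∀ n, U ≤ memV (F^[n] x₀) A := fun n => by
    induction n with
    | zero => exact inf_le_right
    | succ n ih =>
      rw [Function.iterate_succ_apply']
      exact (hstep _ ih).trans inf_le_left
  refine le_iSup_of_le (seqN fun n => F^[n] x₀) (le_inf (isFun_seqN hmem) ?_)
  refine isChain_seqN (s := fun n => F^[n] x₀) fun n => ?_
  rw [Function.iterate_succ_apply']
  exact (hstep _ (hmem n)).trans inf_le_right

end Semantics

/-! ### The topology of the space of functions with finite range -/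

theorem T.exists_bound (f : T) : ∃ B, ∀ n, f.1 n ≤ B := by
  obtain ⟨B, hB⟩ := f.2.bddAbove
  exact ⟨B, fun n => hB ⟨n, rfl⟩⟩

/-- A witness of unboundedness may lie before the stem; `le_stem` moves it to the stem, where
monotonicity takes over. -/
theorem Cond.exists_lt (p : Cond) (C : ℕ) : ∃ N, p.stem ≤ N ∧ ∀ n, N ≤ n → C < p.g n := by
  obtain ⟨m, hm⟩ := p.unbounded C
  refine ⟨max m p.stem, le_max_right _ _, fun n hn => hm.trans_le ?_⟩
  obtain h | h := le_or_gt p.stem m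
  · exact p.mono m n h ((le_max_left _ _).trans hn)
  · exact (p.le_stem m h).trans (p.mono _ n le_rfl ((le_max_right _ _).trans hn))

theorem Cond.isOpen_toSet (p : Cond) : IsOpen p.toSet :=
  isOpen_generateFrom_of_mem ⟨p, rfl⟩

theorem continuous_eval (n : ℕ) : Continuous fun f : T => f.1 n :=
  continuous_discrete_rng.2 fun x => isOpen_value n x

theorem Cond.isClosed_toSet (p : Cond) : IsClosed p.toSet := by
  have h : p.toSet = (⋂ n, ⋂ _ : n < p.stem, {f : T | f.1 n = p.g n}) ∩
      ⋂ n, ⋂ _ : p.stem ≤ n, {f : T | f.1 n ≤ p.g n} := by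
    ext f
    simp [Cond.toSet]
  rw [h]
  refine (isClosed_iInter fun n => isClosed_iInter fun _ => ?_).inter
    (isClosed_iInter fun n => isClosed_iInter fun _ => ?_)
  · exact isClosed_eq (continuous_eval n) continuous_const
  · exact isClosed_le (continuous_eval n) continuous_const

/-- The new stem reaches to where both sequences exceed a bound of `f`, so that the recorded values
of `f` satisfy `le_stem`. -/
theorem Cond.exists_subset_inter {p q : Cond} {f : T} (hp : f ∈ p.toSet) (hq : f ∈ q.toSet) :
    ∃ r : Cond, f ∈ r.toSet ∧ r.toSet ⊆ p.toSet ∩ q.toSet := by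
  obtain ⟨B, hB⟩ := f.exists_bound
  obtain ⟨M, hM, hpM⟩ := p.exists_lt B
  obtain ⟨N, hN, hqN⟩ := q.exists_lt B
  refine ⟨{
    g := fun n => if n < max M N then f.1 n else min (p.g n) (q.g n)
    stem := max M N
    unbounded := fun C => ?_
    mono := fun m n hm hmn => ?_
    le_stem := fun i hi => ?_ }, ⟨fun n hn => ?_, fun n hn => ?_⟩,
    fun h hh => ⟨⟨fun n hn => ?_, fun n hn => ?_⟩, ⟨fun n hn => ?_, fun n hn => ?_⟩⟩⟩
  · obtain ⟨K, -, hK⟩ := p.exists_lt C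
    obtain ⟨L, -, hL⟩ := q.exists_lt C
    refine ⟨max (max K L) (max M N), ?_⟩
    rw [if_neg (by omega)]
    exact lt_min (hK _ (by omega)) (hL _ (by omega))
  · rw [if_neg (by omega), if_neg (by omega)]
    exact min_le_min (p.mono m n (by omega) hmn) (q.mono m n (by omega) hmn)
  · rw [if_pos hi, if_neg (by omega)]
    exact (hB i).trans (le_min (hpM _ (le_max_left _ _)).le (hqN _ (le_max_right _ _)).le)
  · exact (if_pos hn).symm
  · simp only [if_neg hn.not_gt]
    exact (hB n).trans (le_min (hpM _ ((le_max_left _ _).trans hn)).le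
      (hqN _ ((le_max_right _ _).trans hn)).le)
  all_goals
    have h1 := hh.1 n
    have h2 := hh.2 n
    have h3 := hp.1 n
    have h4 := hp.2 n
    have h5 := hq.1 n
    have h6 := hq.2 n
    dsimp only at h1 h2
    split_ifs at h1 h2 <;> omega

theorem exists_cond_subset {U : Set T} (hU : IsOpen U) {f : T} (hf : f ∈ U) :
    ∃ p : Cond, f ∈ p.toSet ∧ p.toSet ⊆ U := by
  induction hU with
  | basic s hs =>
    obtain ⟨p, rfl⟩ := hs
    exact ⟨p, hf, subset_rfl⟩
  | univ =>
    obtain ⟨B, hB⟩ := f.exists_bound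
    refine ⟨{
      g := fun n => B + n
      stem := 0
      unbounded := fun C => ⟨C + 1, by omega⟩
      mono := fun m n _ h => by omega
      le_stem := fun i hi => absurd hi i.not_lt_zero }, ⟨fun n hn => absurd hn n.not_lt_zero,
      fun n _ => (hB n).trans (Nat.le_add_right _ _)⟩, Set.subset_univ _⟩
  | inter s t _ _ hs ht =>
    obtain ⟨p, hp, hps⟩ := hs hf.1
    obtain ⟨q, hq, hqt⟩ := ht hf.2
    obtain ⟨r, hr, hrpq⟩ := Cond.exists_subset_inter hp hq
    exact ⟨r, hr, hrpq.trans (Set.inter_subset_inter hps hqt)⟩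
  | sUnion S _ ih =>
    obtain ⟨s, hs, hfs⟩ := hf
    obtain ⟨p, hp, hps⟩ := ih s hs hfs
    exact ⟨p, hp, hps.trans (Set.subset_sUnion_of_mem hs)⟩

/-- The functions bounded by a sequence. -/
def boundSet (H : ℕ → ℕ) : Set T := {f | ∀ n, f.1 n ≤ H n}

theorem isOpen_boundSet {H : ℕ → ℕ} (hm : Monotone H) (hu : ∀ B, ∃ n, B < H n) :
    IsOpen (boundSet H) := by
  convert Cond.isOpen_toSet {
    g := H
    stem := 0
    unbounded := hu
    mono := fun m n _ h => hm h
    le_stem := fun i hi => absurd hi i.not_lt_zero }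
  ext f
  simp [boundSet, Cond.toSet]

/-- The inclusion of the functions bounded by a number `B`. -/
def ofFin (B : ℕ) (x : ℕ → Fin (B + 1)) : T :=
  ⟨fun n => x n, (Set.finite_lt_nat (B + 1)).subset (by rintro _ ⟨n, rfl⟩; exact (x n).2)⟩

theorem range_ofFin (B : ℕ) : Set.range (ofFin B) = boundSet fun _ => B := by
  ext f
  refine ⟨?_, fun h => ⟨fun n => ⟨f.1 n, Nat.lt_succ_of_le (h n)⟩, rfl⟩⟩
  rintro ⟨x, rfl⟩ n
  exact Nat.lt_succ_iff.1 (x n).2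

/-- The sequence of a condition eventually exceeds `B`, so on functions bounded by `B` it restricts
only finitely many coordinates. -/
theorem continuous_ofFin (B : ℕ) : Continuous (ofFin B) := by
  refine continuous_generateFrom_iff.2 ?_
  rintro _ ⟨p, rfl⟩
  obtain ⟨N, hN, hB⟩ := p.exists_lt B
  have h : ofFin B ⁻¹' p.toSet = ⋂ n ∈ Finset.range N, (fun x : ℕ → Fin (B + 1) => x n) ⁻¹'
      {k | (n < p.stem → (k : ℕ) = p.g n) ∧ (p.stem ≤ n → (k : ℕ) ≤ p.g n)} := by
    ext x
    simp only [Set.mem_preimage, Set.mem_iInter, Finset.mem_range, Set.mem_ofPred_eq]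
    refine ⟨fun h n _ => ⟨h.1 n, h.2 n⟩, fun h => ⟨fun n hn => (h n (by omega)).1 hn,
      fun n hn => ?_⟩⟩
    obtain hnN | hnN := lt_or_ge n N
    · exact (h n hnN).2 hn
    · exact (Nat.lt_succ_iff.1 (x n).2).trans (hB n hnN).le
  rw [h]
  exact isOpen_biInter_finset fun n _ => (isOpen_discrete _).preimage (continuous_apply n)

theorem isCompact_boundSet_const (B : ℕ) : IsCompact (boundSet fun _ => B) := by
  rw [← range_ofFin]
  exact isCompact_range (continuous_ofFin B)

/-- An open set containing all functions bounded by `B` contains all functions bounded by some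
unbounded sequence which is at least `B`. -/
theorem exists_boundSet_subset {W : Set T} (hW : IsOpen W) {B : ℕ}
    (hB : boundSet (fun _ => B) ⊆ W) :
    ∃ H : ℕ → ℕ, Monotone H ∧ (∀ C, ∃ n, C < H n) ∧ (∀ n, B ≤ H n) ∧ boundSet H ⊆ W := by
  -- The property of subsets to which compactness induction applies. Letting `t` range over all
  -- lengths from `t₀` on allows two subsets to be joined, with the larger threshold and the smaller
  -- sequence.
  have key : ∃ (t₀ : ℕ) (H : ℕ → ℕ), (∀ m n, t₀ ≤ m → m ≤ n → H m ≤ H n) ∧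
      (∀ C, ∃ N, ∀ n, N ≤ n → C < H n) ∧
      ∀ t, t₀ ≤ t → ∀ f : T, ∀ f₀ ∈ boundSet (fun _ => B), (∀ n < t, f.1 n = f₀.1 n) →
        (∀ n, t ≤ n → f.1 n ≤ H n) → f ∈ W := by
    refine (isCompact_boundSet_const B).induction_on (p := fun s => ∃ (t₀ : ℕ) (H : ℕ → ℕ),
      (∀ m n, t₀ ≤ m → m ≤ n → H m ≤ H n) ∧ (∀ C, ∃ N, ∀ n, N ≤ n → C < H n) ∧
      ∀ t, t₀ ≤ t → ∀ f : T, ∀ f₀ ∈ s, (∀ n < t, f.1 n = f₀.1 n) →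
        (∀ n, t ≤ n → f.1 n ≤ H n) → f ∈ W) ?_ ?_ ?_ ?_
    · exact ⟨0, id, fun m n _ h => h, fun C => ⟨C + 1, fun n hn => hn⟩,
        fun t _ f f₀ h => absurd h (Set.notMem_empty _)⟩
    · rintro s s' hs ⟨t₀, H, h1, h2, h3⟩
      exact ⟨t₀, H, h1, h2, fun t ht f f₀ hf₀ => h3 t ht f f₀ (hs hf₀)⟩
    · rintro s s' ⟨t, H, h1, h2, h3⟩ ⟨t', H', h1', h2', h3'⟩
      refine ⟨max t t', fun n => min (H n) (H' n), fun m n hm hmn =>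
        min_le_min (h1 m n (by omega) hmn) (h1' m n (by omega) hmn), fun C => ?_, ?_⟩
      · obtain ⟨M, hM⟩ := h2 C
        obtain ⟨M', hM'⟩ := h2' C
        exact ⟨max M M', fun n hn => lt_min (hM n (by omega)) (hM' n (by omega))⟩
      · rintro k hk f f₀ (hf₀ | hf₀) hlt hge
        · exact h3 k (by omega) f f₀ hf₀ hlt fun n hn => (hge n hn).trans (min_le_left _ _)
        · exact h3' k (by omega) f f₀ hf₀ hlt fun n hn => (hge n hn).trans (min_le_right _ _)
    · intro f₀ hf₀
      obtain ⟨p, hp, hpW⟩ := exists_cond_subset hW (hB hf₀)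
      refine ⟨p.toSet, mem_nhdsWithin_of_mem_nhds (p.isOpen_toSet.mem_nhds hp), p.stem, p.g,
        p.mono, fun C => ?_, fun t ht f f₁ hf₁ h h' => hpW ⟨fun n hn => ?_, fun n hn => ?_⟩⟩
      · obtain ⟨N, -, hN⟩ := p.exists_lt C
        exact ⟨N, hN⟩
      · rw [h n (by omega), hf₁.1 n hn]
      · obtain hnt | hnt := lt_or_ge n t
        · rw [h n hnt]
          exact hf₁.2 n hn
        · exact h' n hnt
  obtain ⟨t₀, H, h1, h2, h3⟩ := key
  obtain ⟨N, hN⟩ := h2 B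
  have hle : ∀ n, max t₀ N ≤ n → B < H n := fun n hn => hN n (by omega)
  refine ⟨fun n => if n < max t₀ N then B else H n, fun m n hmn => ?_, fun C => ?_,
    fun n => ?_, fun f hf => ?_⟩
  · dsimp only
    split_ifs with hm hn hn
    · exact le_rfl
    · exact (hle n (by omega)).le
    · omega
    · exact h1 m n (by omega) hmn
  · obtain ⟨M, hM⟩ := h2 C
    refine ⟨max M (max t₀ N), ?_⟩
    dsimp only
    rw [if_neg (by omega)]
    exact hM _ (by omega)
  · dsimp only
    split_ifs with hn
    · exact le_rfl
    · exact (hle n (by omega)).le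
  -- The truncation of `f` at `B` agrees with `f` below the threshold, where the new sequence is
  -- `B`.
  · let f₀ : T := ⟨fun n => min (f.1 n) B, (Set.finite_le_nat B).subset
      (Set.range_subset_iff.2 fun n => Set.mem_ofPred_eq ▸ min_le_right _ _)⟩
    refine h3 (max t₀ N) (le_max_left _ _) f f₀ (fun n => min_le_right _ _) (fun n hn => ?_)
      fun n hn => ?_
    · have := hf n
      simp only [if_pos hn] at this
      exact (min_eq_left this).symm
    · simpa only [if_neg hn.not_gt] using hf n

/-- Every family of open sets has a countable subfamily with the same union. -/
theorem exists_countable_iUnion {ι : Type*} (O : ι → Set T) (hO : ∀ i, IsOpen (O i)) :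
    ∃ S : Set ι, S.Countable ∧ ⋃ i ∈ S, O i = ⋃ i, O i := by
  -- Each product of finite discrete spaces is second countable, and the images of these products
  -- exhaust `T`.
  choose S hS hSU using fun B => isOpen_iUnion_countable (fun i => ofFin B ⁻¹' O i)
    fun i => (hO i).preimage (continuous_ofFin B)
  refine ⟨⋃ B, S B, Set.countable_iUnion hS, subset_antisymm
    (Set.iUnion₂_subset fun i _ => Set.subset_iUnion O i) fun f hf => ?_⟩
  obtain ⟨B, hB⟩ := f.exists_bound
  have hfB : f ∈ boundSet fun _ => B := hB
  rw [← range_ofFin] at hfB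
  obtain ⟨x, rfl⟩ := hfB
  have hx : x ∈ ⋃ i, ofFin B ⁻¹' O i := by simpa using hf
  rw [← hSU B] at hx
  simp only [Set.mem_iUnion, Set.mem_preimage, exists_prop] at hx ⊢
  obtain ⟨i, hi, hix⟩ := hx
  exact ⟨i, ⟨B, hi⟩, hix⟩

/-- Every nonempty family of open sets has a refinement to a sequence of pairwise disjoint open
sets with the same union. -/
theorem exists_disjoint_refinement {ι : Type*} [Nonempty ι] (O : ι → Opens T) :
    ∃ (D : ℕ → Opens T) (i : ℕ → ι), (∀ m n, m ≠ n → D m ⊓ D n = ⊥) ∧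
      (∀ n, D n ≤ O (i n)) ∧ ⨆ i, O i ≤ ⨆ n, D n := by
  -- Passing to basic sets makes the pieces clopen, which keeps them open after subtracting earlier
  -- ones.
  let κ := {q : Cond × ι // q.1.toSet ⊆ O q.2}
  obtain ⟨S, hS, hSU⟩ := exists_countable_iUnion (fun q : κ => q.1.1.toSet)
    fun q => q.1.1.isOpen_toSet
  have hcover : ∀ f, f ∈ ⨆ i, O i → ∃ q ∈ S, f ∈ q.1.1.toSet := fun f hf => by
    obtain ⟨i, hi⟩ := Opens.mem_iSup.1 hf
    obtain ⟨p, hp, hpO⟩ := exists_cond_subset (O i).2 hi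
    have : f ∈ ⋃ q ∈ S, q.1.1.toSet := by
      rw [hSU]
      exact Set.mem_iUnion.2 ⟨⟨(p, i), hpO⟩, hp⟩
    simpa only [Set.mem_iUnion, exists_prop] using this
  obtain rfl | hne := S.eq_empty_or_nonempty
  · refine ⟨fun _ => ⊥, fun _ => Classical.arbitrary ι, fun _ _ _ => inf_bot_eq _,
      fun _ => bot_le, fun f hf => ?_⟩
    obtain ⟨q, hq, -⟩ := hcover f hf
    exact absurd hq (Set.notMem_empty q)
  · obtain ⟨e, rfl⟩ := hS.exists_eq_range hne
    have hclopen : ∀ n, IsClopen (disjointed (fun n => (e n).1.1.toSet) n) := fun n =>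
      disjointedRec (fun s i (hs : IsClopen s) =>
        hs.diff ⟨(e i).1.1.isClosed_toSet, (e i).1.1.isOpen_toSet⟩)
        ⟨(e n).1.1.isClosed_toSet, (e n).1.1.isOpen_toSet⟩
    refine ⟨fun n => ⟨_, (hclopen n).2⟩, fun n => (e n).1.2, fun m n hmn => ?_, fun n => ?_,
      fun f hf => ?_⟩
    · exact Opens.ext ((disjoint_disjointed (fun n => (e n).1.1.toSet) hmn).inter_eq)
    · exact (disjointed_subset (fun n => (e n).1.1.toSet) n).trans (e n).2
    · obtain ⟨_, ⟨n, rfl⟩, hn⟩ := hcover f hf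
      have : f ∈ ⋃ n, disjointed (fun n => (e n).1.1.toSet) n := by
        rw [iUnion_disjointed]
        exact Set.mem_iUnion.2 ⟨n, hn⟩
      obtain ⟨m, hm⟩ := Set.mem_iUnion.1 this
      exact Opens.mem_iSup.2 ⟨m, hm⟩

/-! ### The maximum principle -/

/-- The name which on each `D n` coincides with `z n`. -/
def mixN {H : Type v} [Order.Frame H] (D : ℕ → H) (z : ℕ → Name.{u, v} H) : Name.{u, v} H :=
  Name.mk (Σ n : ULift.{u} ℕ, (z n.down).idx) (fun q => (z q.1.down).elt q.2)
    fun q => D q.1.down ⊓ (z q.1.down).val q.2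

/-- Below `D n`, members contributed by any other `z m` have value `⊥` by disjointness. -/
theorem le_eqV_mixN {H : Type v} [Order.Frame H] {D : ℕ → H} (hD : ∀ m n, m ≠ n → D m ⊓ D n = ⊥)
    (z : ℕ → Name.{u, v} H) (n : ℕ) : D n ≤ eqV (z n) (mixN D z) := by
  rw [eqV_eq]
  refine le_inf (le_iInf fun i => le_himp_iff.2 ?_) (le_iInf ?_)
  · rw [memV_eq]
    refine le_iSup_of_le (⟨⟨n⟩, i⟩ : Σ n : ULift.{u} ℕ, (z n.down).idx) (le_inf le_rfl ?_)
    exact le_top.trans (eqV_self _).ge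
  · rintro ⟨⟨m⟩, j⟩
    refine le_himp_iff.2 ?_
    change D n ⊓ (D m ⊓ (z m).val j) ≤ memV ((z m).elt j) (z n)
    obtain rfl | h := eq_or_ne n m
    · rw [memV_eq]
      refine le_iSup_of_le j (le_inf (inf_le_of_right_le inf_le_right) ?_)
      exact le_top.trans (eqV_self _).ge
    · rw [← inf_assoc, hD n m h, bot_inf_eq]
      exact bot_le

/-- Although `z` ranges over all names, the refinement is a sequence, so the mixed name is again
indexed by a ground-model set. -/
theorem maximum_principle (φ : Model.{u} → Opens T) (hφ : Ext φ) : ∃ y, ⨆ z, φ z ≤ φ y := by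
  have : Nonempty Model.{u} := ⟨check ∅⟩
  obtain ⟨D, z, hD, hDz, hcov⟩ := exists_disjoint_refinement φ
  exact ⟨mixN D z, hcov.trans (iSup_le fun n => hφ.le (le_eqV_mixN hD z n) (hDz n))⟩

/-! ### The generic function -/

theorem mem_valueOpen {n x : ℕ} {f : T} : f ∈ valueOpen n x ↔ f.1 n = x := Iff.rfl

theorem iSup_valueOpen (n : ℕ) : ⨆ m, valueOpen n m = ⊤ :=
  top_unique fun f _ => Opens.mem_iSup.2 ⟨f.1 n, rfl⟩

theorem valueOpen_inf_of_ne (n : ℕ) {x y : ℕ} (h : x ≠ y) : valueOpen n x ⊓ valueOpen n y = ⊥ :=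
  eq_bot_iff.2 fun _ hf => absurd (hf.1.symm.trans hf.2) h

theorem memV_genericFun (z : Model.{u}) :
    memV z genericFun = ⨆ (n : ℕ) (m : ℕ), valueOpen n m ⊓ eqV z (pairN (natN n) (natN m)) := by
  rw [genericFun, memV]
  simp only [eqV_congr_right (eqV_check_psPair _ _)]
  rw [← iSup_prod (f := fun i : ℕ × ℕ => valueOpen i.1 i.2 ⊓ eqV z (pairN (natN i.1) (natN i.2)))]
  exact Equiv.ulift.iSup_congr fun _ => rfl

theorem memV_rngG (y : Model.{u}) :
    memV y rngG = ⨆ (n : ℕ) (m : ℕ), valueOpen n m ⊓ eqV y (natN m) := by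
  rw [rngG, memV, ← iSup_prod (f := fun i : ℕ × ℕ => valueOpen i.1 i.2 ⊓ eqV y (natN i.2))]
  exact Equiv.ulift.iSup_congr fun _ => rfl

theorem appV_genericFun (x y : Model.{u}) : appV genericFun x y =
    ⨆ n, eqV x (natN n) ⊓ ⨆ m, valueOpen n m ⊓ eqV y (natN m) := by
  rw [appV_eq, memV_genericFun]
  simp only [eqV_pairN, inf_iSup_eq]
  exact iSup_congr fun n => iSup_congr fun m => inf_left_comm _ _ _

theorem isFunOn_genericFun : isFunOn genericFun.{u} omegaN = ⊤ := by
  refine isFunOn_omegaN appV_genericFun ?_ (fun n => ?_) fun n y y' => ?_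
  · rintro ⟨n, m⟩
    refine le_top.trans (le_iSup_of_le n (le_iSup_of_le (natN m) ?_))
    rw [isPair_eq]
    exact (eqV_check_psPair _ _).ge
  · refine top_unique ((iSup_valueOpen n).ge.trans (iSup_le fun m => ?_))
    exact le_iSup_of_le (natN m) (le_iSup_of_le m (by rw [eqV_self, inf_top_eq]))
  · rw [iSup_inf_iSup]
    refine iSup_le fun ⟨m, m'⟩ => ?_
    obtain rfl | h := eq_or_ne m m'
    · exact le_eqV_trans (inf_le_of_left_le inf_le_right)
        (inf_le_of_right_le (inf_le_right.trans (eqV_symm _ _).le))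
    · rw [inf_inf_inf_comm, valueOpen_inf_of_ne n h, bot_inf_eq]
      exact bot_le

theorem isRange_rngG : isRange rngG.{u} genericFun omegaN = ⊤ := by
  refine top_unique (le_iInf fun y => ?_)
  have h : exIn omegaN (fun x => appV genericFun x y) = memV y rngG.{u} := by
    rw [exIn_omegaN (Ext.appV (Cong.const _) Cong.id (Cong.const _)), memV_rngG]
    refine le_antisymm (iSup_le fun n => ?_) (iSup_mono fun n => ?_)
    · rw [appV_genericFun]
      refine iSup_le fun k => ?_
      exact inf_le_of_right_le (le_iSup (fun n => ⨆ m, valueOpen n m ⊓ eqV y (natN m)) k)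
    · rw [appV_genericFun]
      exact le_iSup_of_le n (by rw [eqV_self, top_inf_eq])
  rw [h, iffV_self]

theorem subsetV_rngG : subsetV rngG.{u} omegaN = ⊤ := by
  refine top_unique (le_iInf fun y => le_himp_iff.2 (inf_le_of_right_le ?_))
  change memV y rngG ≤ memV y omegaN
  rw [memV_rngG, memV_omegaN]
  exact iSup_le fun _ => iSup_mono fun _ => inf_le_right

theorem isFun_genericFun : isFun genericFun.{u} omegaN omegaN = ⊤ := by
  refine top_unique (le_inf isFunOn_genericFun.ge (le_iInf fun x => le_iInf fun y =>
    le_himp_iff.2 (inf_le_of_right_le ?_)))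
  rw [appV_genericFun, memV_omegaN]
  exact iSup_le fun _ => inf_le_of_right_le (iSup_mono fun _ => inf_le_right)

theorem countableV_rngG : countableV rngG.{u} = ⊤ :=
  top_unique (le_iSup_of_le genericFun (le_inf isFunOn_genericFun.ge isRange_rngG.ge))

theorem memV_check_pointSet (z : Model.{u}) (f : T) :
    memV z (check (pointSet f)) = ⨆ n, eqV z (pairN (natN n) (natN (f.1 n))) := by
  rw [memV_check]
  exact Equiv.ulift.iSup_congr fun n => (eqV_congr_right (eqV_check_psPair _ _) z).symm

theorem isGenericFun_genericFun : isGenericFun genericFun.{u} = ⊤ := by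
  refine top_unique (le_iInf fun z => ?_)
  have hE : Ext fun r : Model.{u} => allIn r fun f => memV z f :=
    Ext.allIn Cong.id fun _ => Ext.const _
  have hall : ∀ r : Opens T, (allIn (check (openSet r)) fun f => memV z f) =
      ⨅ f : {f // f ∈ r}, ⨆ n, eqV z (pairN (natN n) (natN (f.1.1 n))) := fun r => by
    rw [allIn_eq (Ext.memV_right z), openSet, check]
    refine Equiv.ulift.iInf_congr fun f => ?_
    rw [← memV_check_pointSet]
    exact top_himp.symm
  have h : (exIn genericFilter fun r => allIn r fun f => memV z f) = memV z genericFun := by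
    rw [exIn_eq hE, memV_genericFun]
    refine le_antisymm (iSup_le ?_) (iSup_le fun n => iSup_le fun m => ?_)
    · rintro ⟨r⟩
      change r ⊓ (allIn (check (openSet r)) fun f => memV z f) ≤ _
      rw [hall]
      rintro f ⟨hr, hf⟩
      -- The point `f` is itself one of the members of `r`, so the universal statement can be
      -- instantiated at it.
      have hf' := (iInf_le (fun f : {f // f ∈ r} =>
        ⨆ n, eqV z (pairN (natN n) (natN (f.1.1 n)))) ⟨f, hr⟩) hf
      obtain ⟨n, hn⟩ := Opens.mem_iSup.1 hf'
      exact Opens.mem_iSup.2 ⟨n, Opens.mem_iSup.2 ⟨f.1 n, rfl, hn⟩⟩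
    · refine le_iSup_of_le (⟨valueOpen n m⟩ : ULift.{u} (Opens T)) (le_inf inf_le_left ?_)
      change _ ≤ (allIn (check (openSet (valueOpen n m))) fun f => memV z f)
      rw [hall]
      rintro f ⟨-, hf⟩
      refine (le_iInf fun g => ?_ : eqV z (pairN (natN n) (natN m)) ≤ _) hf
      refine le_iSup_of_le n ?_
      rw [mem_valueOpen.1 g.2]
  rw [h, iffV_self]

/-! ### The range of the generic function is unbounded but pseudo-bounded -/

theorem boundedV_rngG : boundedV rngG.{u} = ⊥ := by
  rw [boundedV, exIn_omegaN (Ext.allIn (Cong.const _) fun x => Ext.leV (Cong.const x) Cong.id)]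
  refine eq_bot_iff.2 (iSup_le fun B f hf => ?_)
  rw [allIn_eq (Ext.leV Cong.id (Cong.const _))] at hf
  have hle : ∀ n, (⨅ i, rngG.{u}.val i ⇨ leV (rngG.elt i) (natN B)) ≤ (valueOpen n (B + 1))ᶜ :=
    fun n => by
      refine (iInf_le _ (⟨(n, B + 1)⟩ : ULift.{u} (ℕ × ℕ))).trans ?_
      change valueOpen n (B + 1) ⇨ leV (natN (B + 1)) (natN B) ≤ _
      rw [leV_natN_of_lt B.lt_succ_self, himp_bot]
  obtain ⟨p, hp, hpU⟩ := exists_cond_subset (Opens.isOpen _) hf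
  obtain ⟨N, hN, hgN⟩ := p.exists_lt B
  -- From `N` on the condition allows values above `B`, so this change of `f` stays inside it.
  let h : T := ⟨Function.update f.1 N (B + 1), (f.2.insert (B + 1)).subset
    (Set.range_subset_iff.2 fun n => by
      obtain rfl | hn := eq_or_ne n N
      · simp
      · simp [hn])⟩
  have hhp : h ∈ p.toSet := by
    refine ⟨fun n hn => ?_, fun n hn => ?_⟩
    · exact (Function.update_of_ne (by omega) _ _).trans (hp.1 n hn)
    · obtain rfl | hnN := eq_or_ne n N
      · exact (Function.update_self n _ _).le.trans (hgN n le_rfl)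
      · exact (Function.update_of_ne hnN _ _).le.trans (hp.2 n hn)
  have hbot : h ∈ valueOpen N (B + 1) ⊓ (valueOpen N (B + 1))ᶜ :=
    ⟨Function.update_self N _ _, hle N (hpU hhp)⟩
  rw [inf_compl_self] at hbot
  exact hbot.elim

theorem seqPseudoBounded_eq {H : Type v} [Order.Frame H] (a : Name.{u, v} H) :
    seqPseudoBounded a = ⨅ k : ℕ, ⨆ N : ℕ, ⨅ n : ℕ, leV (natN.{u} N) (natN n) ⇨
      ⨆ l, appV a (natN n) l ⊓ mulLt (natN k) l (natN n) := by
  refine (allIn_omegaN (Ext.exIn (Cong.const _) fun _ => Ext.allIn (Cong.const _) fun _ =>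
    Ext.himp (Ext.const _) (Ext.iSup fun _ => Ext.inf (Ext.const _)
      (Ext.mulLt Cong.id (Cong.const _) (Cong.const _))))).trans (iInf_congr fun k => ?_)
  refine (exIn_omegaN (Ext.allIn (Cong.const _) fun _ => Ext.himp (Ext.leV Cong.id
    (Cong.const _)) (Ext.const _))).trans (iSup_congr fun N => ?_)
  exact allIn_omegaN (Ext.himp (Ext.leV (Cong.const _) Cong.id) (Ext.iSup fun _ =>
    Ext.inf (Ext.appV (Cong.const _) Cong.id (Cong.const _))
      (Ext.mulLt (Cong.const _) (Cong.const _) Cong.id)))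

/-- The pointwise infimum of unbounded monotone sequences `H m` whose lower bounds `b m` tend to
infinity is again monotone and unbounded. -/
theorem monotone_unbounded_iInf {H : ℕ → ℕ → ℕ} {b : ℕ → ℕ} (hm : ∀ m, Monotone (H m))
    (hu : ∀ m C, ∃ j, C < H m j) (hb : ∀ m j, b m ≤ H m j)
    (hbt : ∀ C, ∃ M, ∀ m, M ≤ m → C < b m) :
    Monotone (fun j => ⨅ m, H m j) ∧ ∀ C, ∃ j, C < ⨅ m, H m j := by
  refine ⟨fun i j hij => ciInf_mono (OrderBot.bddBelow _) fun m => hm m hij, fun C => ?_⟩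
  obtain ⟨M, hM⟩ := hbt C
  choose j hj using fun m => hu m C
  -- Only the finitely many sequences before `M` need their own witnesses; the others exceed `C`
  -- everywhere.
  refine ⟨(Finset.range M).sup j, Nat.lt_of_succ_le (le_ciInf fun m => ?_)⟩
  obtain h | h := lt_or_ge m M
  · exact (hj m).trans_le (hm m (Finset.le_sup (f := j) (Finset.mem_range.2 h)))
  · exact (hM m h).trans_le (hb m _)

theorem pseudoBounded_rngG : pseudoBounded rngG.{u} = ⊤ := by
  refine top_unique (le_iInf fun a => le_himp_iff.2 (inf_le_of_right_le ?_))
  rw [seqPseudoBounded_eq]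
  refine le_iInf fun k f hf => ?_
  set U := isFun a omegaN rngG.{u}
  set W : ℕ → Opens T := fun n => ⨆ l, appV a (natN n) l ⊓ mulLt (natN k) l (natN n)
  have htotal : ∀ n : ℕ, U ≤ ⨆ y, appV a (natN n) y := fun n => by
    refine inf_le_of_left_le (inf_le_of_left_le (inf_le_of_right_le ?_))
    rw [allIn_omegaN (Ext.iSup fun y => Ext.appV (Cong.const _) Cong.id (Cong.const _))]
    exact iInf_le _ n
  have hrng : ∀ x y, U ⊓ appV a x y ≤ memV y rngG := fun x y =>
    le_himp_iff.1 (inf_le_of_right_le ((iInf_le _ x).trans (iInf_le _ y)))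
  -- The value `m` of `a_n` is a value of `h`, so `(k + 1) * m ≤ n - 1`. Using `k + 1` covers `k =
  -- 0`, and `0 < n` guards the truncated subtraction.
  have hUW : ∀ n h, 0 < n → h ∈ U → h ∈ boundSet (fun _ => (n - 1) / (k + 1)) → h ∈ W n :=
    fun n h hn hU hB => by
      obtain ⟨y, hy⟩ := Opens.mem_iSup.1 (htotal n hU)
      have hy' : h ∈ memV y rngG := hrng _ y ⟨hU, hy⟩
      rw [memV_rngG] at hy'
      obtain ⟨i, hi⟩ := Opens.mem_iSup.1 hy'
      obtain ⟨m, him, hm⟩ := Opens.mem_iSup.1 hi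
      have hlt : k * m < n := by
        have h1 : m ≤ (n - 1) / (k + 1) := him ▸ hB i
        have h2 := (Nat.le_div_iff_mul_le k.succ_pos).1 h1
        rw [Nat.mul_succ] at h2
        rw [mul_comm]
        omega
      refine Opens.mem_iSup.2 ⟨y, hy, ?_⟩
      refine (Ext.mulLt (Cong.const (natN k)) Cong.id (Cong.const (natN n))).le
        (x := natN m) (c := eqV y (natN m)) (eqV_symm _ _).le ?_ hm
      exact le_top.trans (mulLt_natN hlt).ge
  obtain ⟨p, hp, hpU⟩ := exists_cond_subset U.2 hf
  obtain ⟨B, hB⟩ := f.exists_bound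
  have hdiv : ∀ C n, (k + 1) * (C + 1) < n → C < (n - 1) / (k + 1) := fun C n h => by
    rw [Nat.lt_iff_add_one_le, Nat.le_div_iff_mul_le k.succ_pos, mul_comm]
    exact Nat.le_sub_one_of_lt h
  -- Chosen so that `(n - 1) / (k + 1)` exceeds the bound `B` of `f` for every `n ≥ N`; this puts
  -- `f` into `V` below.
  let N := (k + 1) * (B + 1) + 1
  have hex : ∀ m, ∃ H : ℕ → ℕ, Monotone H ∧ (∀ C, ∃ j, C < H j) ∧
      (∀ j, (N + m - 1) / (k + 1) ≤ H j) ∧ boundSet H ⊆ p.toSetᶜ ∪ W (N + m) := fun m => by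
    -- Small functions outside `p` need not lie in `W`; adjoining the complement of `p`, open
    -- because `p` is clopen, covers them.
    refine exists_boundSet_subset (p.isClosed_toSet.isOpen_compl.union (W (N + m)).2)
      fun h hh => ?_
    by_cases hhp : h ∈ p.toSet
    · exact Or.inr (hUW _ h (by omega) (hpU hhp) hh)
    · exact Or.inl hhp
  choose H hmono hunb hge hsub using hex
  obtain ⟨hGm, hGu⟩ := monotone_unbounded_iInf hmono hunb hge fun C =>
    ⟨(k + 1) * (C + 1), fun m hm => hdiv C _ (by omega)⟩
  let V : Opens T := ⟨p.toSet ∩ boundSet fun j => ⨅ m, H m j,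
    p.isOpen_toSet.inter (isOpen_boundSet hGm hGu)⟩
  have hfV : f ∈ V := ⟨hp, fun j => le_ciInf fun m =>
    (hB j).trans ((hdiv B _ (by omega)).le.trans (hge m j))⟩
  refine Opens.mem_iSup.2 ⟨N, (le_iInf fun n => le_himp_iff.2 ?_ : V ≤ _) hfV⟩
  obtain hn | hn := lt_or_ge n N
  · rw [leV_natN_of_lt hn, inf_bot_eq]
    exact bot_le
  · obtain ⟨m, rfl⟩ := Nat.exists_eq_add_of_le hn
    refine inf_le_of_left_le fun h hh => ?_
    exact (hsub m fun j => (hh.2 j).trans (ciInf_le (OrderBot.bddBelow _) m)).resolve_left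
      (not_not_intro hh.1)

theorem bdN_eq_bot : bdN.{u, 0} (H := Opens T) = ⊥ := by
  refine eq_bot_iff.2 ((iInf_le _ rngG.{u}).trans ?_)
  rw [subsetV_rngG, countableV_rngG, pseudoBounded_rngG, boundedV_rngG]
  simp

end TopModel

theorem mainTheorem1 :
    -- `G` is the function given by the generic term; it maps `ω` to `ω` and has range `rng(G)`
    TopModel.Forced (TopModel.isGenericFun TopModel.genericFun.{u}) ∧
    TopModel.Forced (TopModel.isFun TopModel.genericFun.{u} TopModel.omegaN TopModel.omegaN) ∧
    TopModel.Forced (TopModel.isRange TopModel.rngG.{u} TopModel.genericFun TopModel.omegaN) ∧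
    -- `rng(G)` is a countable and pseudo-bounded set of natural numbers, and not bounded
    TopModel.Forced (TopModel.subsetV TopModel.rngG.{u} TopModel.omegaN) ∧
    TopModel.Forced (TopModel.countableV TopModel.rngG.{u}) ∧
    TopModel.Forced (TopModel.pseudoBounded TopModel.rngG.{u}) ∧
    TopModel.Forced (TopModel.boundedV TopModel.rngG.{u})ᶜ ∧
    -- BD-ℕ fails
    TopModel.Forced (TopModel.bdN.{u, 0})ᶜ ∧
    -- Dependent Choice, for all formulas with parameters, over the model and on each set
    (∀ (n : ℕ) (φ : TopModel.SetFormula (n + 2)) (w : Fin n → TopModel.Model.{u}),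
      TopModel.Forced (TopModel.dcClass (TopModel.relOf φ w)) ∧
      TopModel.Forced (TopModel.dcSet (TopModel.relOf φ w))) := by
  refine ⟨TopModel.isGenericFun_genericFun, TopModel.isFun_genericFun, TopModel.isRange_rngG,
    TopModel.subsetV_rngG, TopModel.countableV_rngG, TopModel.pseudoBounded_rngG, ?_, ?_,
    fun n φ w => ⟨?_, ?_⟩⟩
  · rw [TopModel.Forced, TopModel.boundedV_rngG, compl_bot]
  · rw [TopModel.Forced, TopModel.bdN_eq_bot, compl_bot]
  · exact TopModel.dcClass_eq_top TopModel.maximum_principle (TopModel.relOf_ext_right φ w)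
  · exact TopModel.dcSet_eq_top TopModel.maximum_principle (TopModel.relOf_ext_right φ w)
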